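/- **Model.** The input is a finite simple connected undirected graph $G$ with $n\ge 1$ nodes; at every node $v$ the incident edges are labelled bijectively by port numbers $0,\dots,\Delta(v)-1$, and $\pi_v(w)$ denotes the port at $v$ of the edge to its neighbour $w$. Nodes are anonymous. Every node has $s$ bits of storage and a single agent has $c$ bits of memory, all initially $0$; the agent starts at an arbitrary node $r$. In one agent step it performs a local computation, which reads its memory, the storage and the degree of the current node, and the port by which it entered (none in the first step), and which rewrites the memory and the storage of the current node and either outputs a port, through which the agent then leaves, or outputs nothing, in which case the agent terminates. The local computation is carried out by one fixed 5-tape Turing machine (tapes: memory, storage, degree, incoming port, outgoing port; one-way infinite, alphabet $\{0,1,\sqcup\}$; degree and incoming port read-only, outgoing port write-only; degree and ports in unary) that starts each time in its initial state with the heads on the first cells, and visits only the first $c$ cells of the memory tape and the first $s$ cells of the storage tape. **Lex-DFS.** Initially all nodes are white and the grey path is empty. First the root $r$ is coloured grey, and the grey path is $(r)$. Let $u$ be the last node of the grey path (the search head). If $u$ has white neighbours, the one, $w$, with the smallest port $\pi_u(w)$ is coloured grey and appended to the grey path; otherwise $u$ is coloured black and removed from the grey path. The search ends when the grey path is empty again.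 **Theorem.** (1) There are a Turing machine $M$ as above, constants $c$ and $s$, a polynomial $P$, and a map from $s$-bit strings to $\{\text{white},\text{grey},\text{black}\}$, by which the storage of a node determines a colour, such that for every such graph $G$ with $n$ nodes and every start node $r$: the agent terminates after at most $P(n)$ agent steps, each with at most $P(n)$ Turing machine steps, and it performs Lex-DFS from $r$. That is, at each time $t$ the colours of all nodes are those of the Lex-DFS from $r$ after its first $\kappa(t)$ moves, where $\kappa$ is nondecreasing, is $0$ at the start, and at termination is the total number of moves; and for every intermediate state of the search with nonempty grey path, there is an agent step that takes place at the search head of that state and before, during or after which the search is in that state. (2) At any moment of Lex-DFS on any such graph, the grey path $u_0,u_1,\dots,u_k$ consists exactly of the grey nodes, $u_0=r$ (if it is nonempty), and for every $i<k$, $u_{i+1}$ is a neighbour of $u_i$ and $\pi_{u_i}(u_{i+1})=\min\{\pi_{u_i}(u_j) : i+1\le j\le k,\ u_j\text{ a neighbour of }u_i\}$. -/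

import Mathlib

universe u

/-! ## Port-numbered graphs -/

/-- A simple connected undirected graph together with a local port numbering: the edges at `v` are
labelled bijectively by `0, …, deg v - 1`. (The bijection forces `deg v` to be the degree.)
The two ports of an edge are unrelated. -/
structure PortGraph (V : Type u) where
  graph : SimpleGraph V
  connected : graph.Connected
  deg : V → ℕ
  port : ∀ v, graph.neighborSet v ≃ Fin (deg v)

namespace PortGraph

variable {V : Type u} (G : PortGraph V)

/-- The port number at `v` of the edge `{v, w}`. -/
def portNum {v w : V} (h : G.graph.Adj v w) : ℕ := G.port v ⟨w, h⟩

/-- The neighbour of `v` behind port `p`. -/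
def nbr (v : V) (p : Fin (G.deg v)) : V := (G.port v).symm p

theorem adj_nbr (v : V) (p : Fin (G.deg v)) : G.graph.Adj v (G.nbr v p) :=
  ((G.port v).symm p).2

end PortGraph

/-! ## Five-tape Turing machines for the local computation -/

inductive TapeSym
  | zero | one | blank

inductive HeadDir
  | left | right

/-- A five-tape machine. Tape `0` is the agent memory, tape `1` the storage of the current node,
tape `2` the degree, tape `3` the incoming port, tape `4` the outgoing port.
Tapes `2` and `3` are read-only and tape `4` is write-only. -/
structure AgentMachine where
  Q : Type
  finite_Q : Finite Q
  start : Q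
  final : Q
  trans : Q → (Fin 5 → TapeSym) → Q × (Fin 5 → TapeSym) × (Fin 5 → HeadDir)
  read_only : ∀ q a, (trans q a).2.1 2 = a 2 ∧ (trans q a).2.1 3 = a 3
  write_only : ∀ q a b, (∀ i, i ≠ 4 → a i = b i) → trans q a = trans q b

/-- Moving a head on a tape that is infinite to the right only. -/
def HeadDir.shift : HeadDir → ℕ → ℕ
  | .left, i => i - 1
  | .right, i => i + 1

structure TMConf (Q : Type) where
  state : Q
  tape : Fin 5 → ℕ → TapeSym
  head : Fin 5 → ℕ

/-- A bit string, followed by blanks. -/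
def encBits {k : ℕ} (b : Fin k → Bool) : ℕ → TapeSym :=
  fun i => if h : i < k then (if b ⟨i, h⟩ then TapeSym.one else TapeSym.zero) else TapeSym.blank

/-- The number `k` in unary: `k` ones, followed by blanks. -/
def encUnary (k : ℕ) : ℕ → TapeSym :=
  fun i => if i < k then TapeSym.one else TapeSym.blank

/-- Port `p` is written as `p + 1` ones, so that port `0` differs from the empty tape, which
means "no port". -/
def encPort : Option ℕ → ℕ → TapeSym
  | none => encUnary 0
  | some p => encUnary (p + 1)

namespace AgentMachine

variable (M : AgentMachine)

/-- One TM step. -/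
def step (x : TMConf M.Q) : TMConf M.Q :=
  let y := M.trans x.state (fun i => x.tape i (x.head i))
  { state := y.1
    tape := fun i => Function.update (x.tape i) (x.head i) (y.2.1 i)
    head := fun i => (y.2.2 i).shift (x.head i) }

/-- The start of a local computation: all heads are on cell `0`. -/
def initial {c s : ℕ} (mem : Fin c → Bool) (sto : Fin s → Bool) (deg : ℕ) (pin : Option ℕ) :
    TMConf M.Q where
  state := M.start
  tape := ![encBits mem, encBits sto, encUnary deg, encPort pin, encUnary 0]
  head := fun _ => 0

/-- With `c` bits of memory and `s` bits of storage, the local computation stops after exactly `τ`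
TM steps, leaving `mem'`, `sto'` and the outgoing port `out` on the tapes; it visits
only the first `c` cells of the memory tape and the first `s` cells of the storage tape. -/
def Computes {c s : ℕ} (mem : Fin c → Bool) (sto : Fin s → Bool) (deg : ℕ) (pin : Option ℕ)
    (τ : ℕ) (mem' : Fin c → Bool) (sto' : Fin s → Bool) (out : Option ℕ) : Prop :=
  let x : ℕ → TMConf M.Q := fun i => M.step^[i] (M.initial mem sto deg pin)
  (∀ i < τ, (x i).state ≠ M.final) ∧ (x τ).state = M.final ∧
  (∀ i ≤ τ, (x i).head 0 < c ∧ (x i).head 1 < s) ∧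
  (x τ).tape 0 = encBits mem' ∧ (x τ).tape 1 = encBits sto' ∧ (x τ).tape 4 = encPort out

end AgentMachine

/-! ## The mobile agent -/

/-- A global configuration: the location of the agent, the port through which it came (`none` at the
beginning), its memory, and the storage of every node. -/
structure AgentConf (V : Type u) (c s : ℕ) where
  loc : V
  pin : Option ℕ
  mem : Fin c → Bool
  sto : V → Fin s → Bool

/-- The agent is at `r`; all bits are zero. -/
def AgentConf.initial {V : Type u} (c s : ℕ) (r : V) : AgentConf V c s where
  loc := r
  pin := none
  mem := fun _ => false
  sto := fun _ _ => false

namespace PortGraph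

variable {V : Type u} [DecidableEq V] (G : PortGraph V)

/-- An agent step with a local computation of `τ` TM steps and a movement through port `p`. -/
def MoveStep (M : AgentMachine) {c s : ℕ} (τ : ℕ) (a b : AgentConf V c s) : Prop :=
  ∃ (mem' : Fin c → Bool) (sto' : Fin s → Bool) (p : Fin (G.deg a.loc)),
    M.Computes a.mem (a.sto a.loc) (G.deg a.loc) a.pin τ mem' sto' (some p) ∧
    b = { loc := G.nbr a.loc p
          pin := some (G.portNum (G.adj_nbr a.loc p).symm)
          mem := mem'
          sto := Function.update a.sto a.loc sto' }

/-- The last agent step: no port is written, and the agent terminates where it is. -/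
def HaltStep (M : AgentMachine) {c s : ℕ} (τ : ℕ) (a b : AgentConf V c s) : Prop :=
  ∃ (mem' : Fin c → Bool) (sto' : Fin s → Bool),
    M.Computes a.mem (a.sto a.loc) (G.deg a.loc) a.pin τ mem' sto' none ∧
    b = { a with mem := mem', sto := Function.update a.sto a.loc sto' }

/-- The execution of `M` from `r` consists of the agent steps `0, …, T`, and terminates in step `T`.
Step `t` leads from `conf t` to `conf (t + 1)` and takes `time t` TM steps. -/
def Execution (M : AgentMachine) {c s : ℕ} (r : V) (T : ℕ) (conf : ℕ → AgentConf V c s)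
    (time : ℕ → ℕ) : Prop :=
  conf 0 = AgentConf.initial c s r ∧
  (∀ t < T, G.MoveStep M (time t) (conf t) (conf (t + 1))) ∧
  G.HaltStep M (time T) (conf T) (conf (T + 1))

end PortGraph

/-! ## Lexicographically ordered depth-first search -/

inductive Colour
  | white | grey | black

/-- A state of the search: the grey path, listed from the search head down to the root, and the
colours of the nodes. -/
structure DFSState (V : Type u) where
  stack : List V
  colour : V → Colour

/-- Before the search. -/
def DFSState.initial (V : Type u) : DFSState V where
  stack := []
  colour := fun _ => Colour.white

/-- The grey path, from the root to the search head. -/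
def DFSState.greyPath {V : Type u} (S : DFSState V) : List V := S.stack.reverse

namespace PortGraph

variable {V : Type u} [DecidableEq V] (G : PortGraph V)

/-- The moves of Lex-DFS with root `r`: the root is discovered; from the search head `v`, the
search advances to the white neighbour `w` of `v` with the smallest port number at `v`; if `v` has no
white neighbour, `v` becomes black and the search backtracks to the preceding node of the grey path
(and ends if `v` is the root). -/
inductive LexMove (r : V) : DFSState V → DFSState V → Prop
  | start : LexMove r (DFSState.initial V)
      ⟨[r], Function.update (DFSState.initial V).colour r Colour.grey⟩
  | forward (v w : V) (rest : List V) (col : V → Colour) (h : G.graph.Adj v w)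
      (hw : col w = Colour.white)
      (hmin : ∀ (x : V) (hx : G.graph.Adj v x), col x = Colour.white →
        G.portNum h ≤ G.portNum hx) :
      LexMove r ⟨v :: rest, col⟩ ⟨w :: v :: rest, Function.update col w Colour.grey⟩
  | back (v : V) (rest : List V) (col : V → Colour)
      (hv : ∀ x : V, G.graph.Adj v x → col x ≠ Colour.white) :
      LexMove r ⟨v :: rest, col⟩ ⟨rest, Function.update col v Colour.black⟩

/-- `S 0, …, S L` is the complete run of Lex-DFS from `r`. -/
def IsLexDFS (r : V) (L : ℕ) (S : ℕ → DFSState V) : Prop :=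
  S 0 = DFSState.initial V ∧ (∀ k < L, G.LexMove r (S k) (S (k + 1))) ∧
  ∀ S', ¬ G.LexMove r (S L) S'

/-- The grey path `u₀, …, u_k` of the state `S` starts at the root `r`, consists of the grey nodes,
and, for `i < k`, the port at `u_i` of the edge to `u_{i+1}` is the minimum of the ports
at `u_i` of the edges to the neighbours of `u_i` among `u_{i+1}, …, u_k`. -/
def GreyPathProperty (r : V) (S : DFSState V) : Prop :=
  (∀ u ∈ S.greyPath.head?, u = r) ∧
  (∀ v, S.colour v = Colour.grey ↔ v ∈ S.greyPath) ∧
  ∀ (i : ℕ) (hi : i + 1 < S.greyPath.length),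
    ∃ h : G.graph.Adj S.greyPath[i] S.greyPath[i + 1],
      IsLeast {p : ℕ | ∃ (j : ℕ) (hj : j < S.greyPath.length)
          (hij : G.graph.Adj S.greyPath[i] S.greyPath[j]), i + 1 ≤ j ∧ p = G.portNum hij}
        (G.portNum h)

/-- The agent steps `0, …, T` carry out Lex-DFS from `r`, where `colour` reads the colour of a node
off its storage. At time `t`, the first `κ t` moves of the search have been made: the
colours in the storage are always those of the current state of the search, and the search is
complete at the end. Moreover, the agent follows the search head: for every state of the search,
there is an agent step at the search head of that state, before, during or after
which the search is in that state. (One agent step writes to one node only, so that it can make two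
moves only if it discovers a node and immediately leaves it for good.) -/
def PerformsLexDFS {c s : ℕ} (r : V) (colour : (Fin s → Bool) → Colour) (T : ℕ)
    (conf : ℕ → AgentConf V c s) : Prop :=
  ∃ (L : ℕ) (S : ℕ → DFSState V) (κ : ℕ → ℕ),
    G.IsLexDFS r L S ∧
    Monotone κ ∧ κ 0 = 0 ∧ κ (T + 1) = L ∧
    (∀ t ≤ T + 1, ∀ v, colour ((conf t).sto v) = (S (κ t)).colour v) ∧
    ∀ k ≤ L, ∀ u ∈ (S k).stack.head?,
      ∃ t ≤ T, κ t ≤ k ∧ k ≤ κ (t + 1) ∧ (conf t).loc = u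

end PortGraph

/-! Part (2) is an invariant. When the search passes from `v` to `f`, the node `f` is the first
white neighbour of `v`, and every node that later follows `f` on the grey path was white at that
moment. The set of white nodes and of grey nodes after `f` never grows while `f` is grey, so the
port of `f` stays minimal in it (`IsRegular.least`, preserved by `LexMove.isRegular`).

For part (1), a constant number of bits cannot hold a pointer to the predecessor of a node. Instead,
after each backtracking the agent returns to the root and retraces the grey path. One bit per grey
node separates the nodes retraced in the current round from the old ones; by the invariant, the
first old neighbour in port order is the next node. A node without old neighbours is the search
head. It leads on to its first white neighbour, or it becomes black and the next round begins.

The way back to the root is also found from labels alone. The agent marks an induced path from the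
root through retraced nodes. On an induced path, the only marked neighbour of the end is its
predecessor. Before a node is appended, the path is cut back until its end is the only node on it
adjacent to the new one.

A scan of a neighbourhood takes at most 2n+2 agent steps, so it remains to bound the number of
scans. Discovering a node leaves `whites S + S.stack.length` unchanged and backtracking lowers it by
one, which pays for the next round. Within a round each appended node is charged a constant, part of
which is kept to pay for its later removal from the marked path. `Invariant` records this bound and
the labels for every kind of scan, and `Invariant.scanning` is the induction on the bound.

Modes and labels form finite types, so `exists_bitEncoding` and `RuleMachine.computes` turn the rule
into a fixed Turing machine, and `Completes.exists_execution` assembles the run. A graph with one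
node has no ports and is treated separately. -/

/-! ## A machine for an arbitrary local rule -/

/-- What a local computation decides: to terminate, to leave through port `0`, to leave through the
incoming port, or to leave through the port after the incoming port; in the last case, the
second value is used with the incoming port if there is no further port. -/
inductive Verdict (α : Type) where
  | halt (a : α)
  | zero (a : α)
  | back (a : α)
  | next (a b : α)

namespace Verdict

instance {α : Type} [Finite α] : Finite (Verdict α) :=
  Finite.of_surjective
    (fun x : α ⊕ α ⊕ α ⊕ (α × α) => match x with
      | .inl a => halt a
      | .inr (.inl a) => zero a
      | .inr (.inr (.inl a)) => back a
      | .inr (.inr (.inr (a, b))) => next a b) (by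
    rintro (a | a | a | ⟨a, b⟩)
    · exact ⟨.inl a, rfl⟩
    · exact ⟨.inr (.inl a), rfl⟩
    · exact ⟨.inr (.inr (.inl a)), rfl⟩
    · exact ⟨.inr (.inr (.inr (a, b))), rfl⟩)

/-- The value and the outgoing port that result from a verdict. -/
inductive Yields {α : Type} (deg : ℕ) : Verdict α → Option ℕ → α → Option ℕ → Prop
  | halt (pin : Option ℕ) (a : α) : Yields deg (halt a) pin a none
  | zero (pin : Option ℕ) (a : α) : Yields deg (zero a) pin a (some 0)
  | back (p : ℕ) (a : α) : Yields deg (back a) (some p) a (some p)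
  | next (p : ℕ) (a b : α) (h : p + 1 < deg) : Yields deg (next a b) (some p) a (some (p + 1))
  | last (p : ℕ) (a b : α) (h : deg ≤ p + 1) : Yields deg (next a b) (some p) b (some p)

def map {α β : Type} (f : α → β) : Verdict α → Verdict β
  | halt a => halt (f a)
  | zero a => zero (f a)
  | back a => back (f a)
  | next a b => next (f a) (f b)

theorem Yields.map {α β : Type} (f : α → β) {deg : ℕ} {d : Verdict α} {pin : Option ℕ} {a : α}
    {out : Option ℕ} (h : Yields deg d pin a out) : Yields deg (d.map f) pin (f a) out := by
  cases h <;> constructor <;> assumption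

end Verdict

namespace RuleMachine

/-- A pair of bit strings: the memory and the storage. -/
abbrev Bits (m : ℕ) : Type := (Fin m → Bool) × (Fin m → Bool)

inductive State (m : ℕ) where
  | read (i : Fin m) (x : Bits m)
  | rewind (i : Fin m) (x : Bits m)
  | port (d : Verdict (Bits m))
  | write (i : Fin m) (x : Bits m)
  | final

instance (m : ℕ) : Finite (State m) :=
  Finite.of_surjective
    (fun x : (Fin m × Bits m) ⊕ (Fin m × Bits m) ⊕ Verdict (Bits m) ⊕ (Fin m × Bits m) ⊕ Unit =>
      match x with
      | .inl (i, x) => State.read i x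
      | .inr (.inl (i, x)) => State.rewind i x
      | .inr (.inr (.inl d)) => State.port d
      | .inr (.inr (.inr (.inl (i, x)))) => State.write i x
      | .inr (.inr (.inr (.inr ()))) => State.final) (by
    rintro (⟨i, x⟩ | ⟨i, x⟩ | d | ⟨i, x⟩ | _)
    · exact ⟨.inl (i, x), rfl⟩
    · exact ⟨.inr (.inl (i, x)), rfl⟩
    · exact ⟨.inr (.inr (.inl d)), rfl⟩
    · exact ⟨.inr (.inr (.inr (.inl (i, x)))), rfl⟩
    · exact ⟨.inr (.inr (.inr (.inr ()))), rfl⟩)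

def isOne : TapeSym → Bool
  | .one => true
  | _ => false

def ofBool (b : Bool) : TapeSym := if b then .one else .zero

/-- The effect of one machine step: the new state, the symbols written to the tapes `0`, `1`, `4`, the
direction of the heads `0`, `1`, and the direction of the heads `2`, `3`, `4`. -/
structure Effect (m : ℕ) where
  state : State m
  sym0 : TapeSym
  sym1 : TapeSym
  sym4 : TapeSym
  dirBits : HeadDir
  dirPort : HeadDir

variable {m : ℕ} (f : Bits m → Bool → Verdict (Bits m))

/-- The finite control holds both bit strings, so only ports need unbounded work, and that is a copy
from tape `3` to tape `4` with heads moving in parallel. A left move on cell `0` serves as standing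
still. As tape `4` cannot be read, each step must write on it: blanks go to cell `0` before the port
phase, and afterwards to cells beyond the output. -/
def effect : State m → TapeSym → TapeSym → TapeSym → TapeSym → Effect m
  | .read i x, s0, s1, _, _ =>
    let y : Bits m := (Function.update x.1 i (isOne s0), Function.update x.2 i (isOne s1))
    if h : i.1 + 1 < m then ⟨.read ⟨i + 1, h⟩ y, s0, s1, .blank, .right, .left⟩
    else ⟨.rewind ⟨0, i.pos⟩ y, s0, s1, .blank, .left, .left⟩
  | .rewind i x, s0, s1, s2, _ =>
    if h : i.1 + 1 < m then ⟨.rewind ⟨i + 1, h⟩ x, s0, s1, .blank, .left, .left⟩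
    else ⟨.port (f x (isOne s2)), s0, s1, .blank, .left, .left⟩
  | .port d, s0, s1, s2, s3 =>
    if hm : 0 < m then
      match d with
      | .halt x => ⟨.write ⟨0, hm⟩ x, s0, s1, .blank, .left, .right⟩
      | .zero x => ⟨.write ⟨0, hm⟩ x, s0, s1, .one, .left, .right⟩
      | .back x =>
        if isOne s3 then ⟨.port d, s0, s1, .one, .left, .right⟩
        else ⟨.write ⟨0, hm⟩ x, s0, s1, .blank, .left, .right⟩
      | .next x y =>
        if isOne s3 then ⟨.port d, s0, s1, .one, .left, .right⟩
        else if isOne s2 then ⟨.write ⟨0, hm⟩ x, s0, s1, .one, .left, .right⟩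
        else ⟨.write ⟨0, hm⟩ y, s0, s1, .blank, .left, .right⟩
    else ⟨.final, s0, s1, .blank, .left, .right⟩
  | .write i x, _, _, _, _ =>
    if h : i.1 + 1 < m then
      ⟨.write ⟨i + 1, h⟩ x, ofBool (x.1 i), ofBool (x.2 i), .blank, .right, .right⟩
    else ⟨.final, ofBool (x.1 i), ofBool (x.2 i), .blank, .left, .right⟩
  | .final, s0, s1, _, _ => ⟨.final, s0, s1, .blank, .left, .left⟩

/-- The machine reads the two bit strings, applies the rule `f` to them and to the
truth value of "the degree is positive", and carries out the verdict. -/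
def machine (hm : 0 < m) : AgentMachine where
  Q := State m
  finite_Q := inferInstance
  start := .read ⟨0, hm⟩ (fun _ => false, fun _ => false)
  final := .final
  trans q a :=
    let e := effect f q (a 0) (a 1) (a 2) (a 3)
    (e.state, ![e.sym0, e.sym1, a 2, a 3, e.sym4],
      ![e.dirBits, e.dirBits, e.dirPort, e.dirPort, e.dirPort])
  read_only _ _ := ⟨rfl, rfl⟩
  write_only q a b h := by
    simp only [h 0 (by decide), h 1 (by decide), h 2 (by decide), h 3 (by decide)]

/-- A configuration in which the heads `0`, `1` are at `h` and the heads `2`, `3`, `4` are at `k`. -/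
def conf (q : State m) (t : Fin 5 → ℕ → TapeSym) (h k : ℕ) : TMConf (State m) :=
  ⟨q, t, ![h, h, k, k, k]⟩

/-! ### Correctness of the machine, phase by phase -/

variable (hm : 0 < m)

theorem step_conf (q : State m) (t0 t1 t2 t3 t4 : ℕ → TapeSym) (h k : ℕ) :
    (machine f hm).step (conf q ![t0, t1, t2, t3, t4] h k) =
      let e := effect f q (t0 h) (t1 h) (t2 k) (t3 k)
      conf e.state ![Function.update t0 h e.sym0, Function.update t1 h e.sym1, t2, t3,
        Function.update t4 k e.sym4] (e.dirBits.shift h) (e.dirPort.shift k) := by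
  simp only [AgentMachine.step, conf, machine]
  congr 1
  · funext i
    fin_cases i <;> simp
  · funext i
    fin_cases i <;> simp

/-- `n` steps lead from `x` to `y`; before `y`, the machine is not in the final state and its first two
heads stay among the first `m` cells. -/
def Leads (x : TMConf (State m)) (n : ℕ) (y : TMConf (State m)) : Prop :=
  (machine f hm).step^[n] x = y ∧
  ∀ i < n, ((machine f hm).step^[i] x).state ≠ State.final ∧
    ((machine f hm).step^[i] x).head 0 < m ∧ ((machine f hm).step^[i] x).head 1 < m

variable {f hm}

theorem Leads.head {x y z : TMConf (State m)} {n : ℕ} (hx : x.state ≠ .final) (h0 : x.head 0 < m)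
    (h1 : x.head 1 < m) (hy : (machine f hm).step x = y) (h : Leads f hm y n z) :
    Leads f hm x (n + 1) z := by
  subst hy
  refine ⟨h.1, fun i hi => ?_⟩
  rcases i with - | i
  · exact ⟨hx, h0, h1⟩
  · exact h.2 i (by omega)

theorem Leads.refl (x : TMConf (State m)) : Leads f hm x 0 x :=
  ⟨rfl, fun _ h => absurd h (by omega)⟩

theorem Leads.single (q : State m) (t0 t1 t2 t3 t4 : ℕ → TapeSym) {h k : ℕ} (hq : q ≠ .final)
    (hh : h < m) {n : ℕ} {z : TMConf (State m)} {e : Effect m}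
    (he : effect f q (t0 h) (t1 h) (t2 k) (t3 k) = e)
    (H : Leads f hm (conf e.state ![Function.update t0 h e.sym0, Function.update t1 h e.sym1, t2, t3,
        Function.update t4 k e.sym4] (e.dirBits.shift h) (e.dirPort.shift k)) n z) :
    Leads f hm (conf q ![t0, t1, t2, t3, t4] h k) (n + 1) z := by
  refine Leads.head hq (by simpa [conf]) (by simpa [conf]) ?_ H
  rw [step_conf, he]

theorem isOne_encBits (b : Fin m → Bool) (i : Fin m) : isOne (encBits b i) = b i := by
  cases h : b i <;> simp [encBits, isOne, h]

theorem update_of_eq {t : ℕ → TapeSym} {k : ℕ} {s : TapeSym} (h : t k = s) :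
    Function.update t k s = t := by
  rw [← h, Function.update_eq_self]

variable (u w : Fin m → Bool) (t2 t3 : ℕ → TapeSym)

/-- Induction on the number of cells still to be written. The heads `2`, `3`, `4` keep moving right,
over cells of tape `4` that are blank already, so the output survives. -/
theorem leads_write (x : Bits m) (t4 : ℕ → TapeSym) (j : ℕ) :
    ∀ (i : Fin m) (t0 t1 : ℕ → TapeSym) (k : ℕ), i.1 + j + 1 = m →
      (∀ l < i.1, t0 l = encBits x.1 l ∧ t1 l = encBits x.2 l) →
      (∀ l ≥ m, t0 l = .blank ∧ t1 l = .blank) → (∀ l ≥ k, t4 l = .blank) →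
      ∃ h < m, Leads f hm (conf (.write i x) ![t0, t1, t2, t3, t4] i k) (j + 1)
        (conf .final ![encBits x.1, encBits x.2, t2, t3, t4] h (k + j + 1)) := by
  induction j with
  | zero =>
    intro i t0 t1 k hi ht hb h4
    have hlast : ¬ i.1 + 1 < m := by omega
    refine ⟨i.1 - 1, by omega, ?_⟩
    refine Leads.single _ _ _ _ _ _ (by simp) i.2 (by simp only [effect, dif_neg hlast]; rfl) ?_
    simp only [HeadDir.shift, update_of_eq (h4 k le_rfl)]
    have key : ∀ (t : ℕ → TapeSym) (b : Fin m → Bool), (∀ l < i.1, t l = encBits b l) →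
        (∀ l ≥ m, t l = .blank) → Function.update t i.1 (ofBool (b i)) = encBits b := by
      intro t b h1 h2
      funext l
      by_cases hl : l = i.1
      · subst hl
        simp [encBits, ofBool]
      · rw [Function.update_of_ne hl]
        by_cases hlt : l < i.1
        · exact h1 l hlt
        · rw [h2 l (by omega), encBits, dif_neg (by omega)]
    rw [key t0 x.1 (fun l hl => (ht l hl).1) (fun l hl => (hb l hl).1),
      key t1 x.2 (fun l hl => (ht l hl).2) (fun l hl => (hb l hl).2)]
    exact Leads.refl _
  | succ j ih =>
    intro i t0 t1 k hi ht hb h4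
    have hlt : i.1 + 1 < m := by omega
    obtain ⟨h, hh, H⟩ := ih ⟨i.1 + 1, hlt⟩ (Function.update t0 i.1 (ofBool (x.1 i)))
      (Function.update t1 i.1 (ofBool (x.2 i))) (k + 1) (by simp; omega) (by
        intro l hl
        by_cases hli : l = i.1
        · subst hli
          simp [encBits, ofBool]
        · rw [Function.update_of_ne hli, Function.update_of_ne hli]
          exact ht l (by simp at hl; omega)) (by
        intro l hl
        rw [Function.update_of_ne (by omega), Function.update_of_ne (by omega)]
        exact hb l hl) (fun l hl => h4 l (by omega))
    refine ⟨h, hh, ?_⟩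
    refine Leads.single _ _ _ _ _ _ (by simp) i.2 (by simp only [effect, dif_pos hlt]; rfl) ?_
    simp only [HeadDir.shift, update_of_eq (h4 k le_rfl)]
    rw [show k + (j + 1) + 1 = k + 1 + j + 1 by omega]
    exact H

theorem update_encUnary (k : ℕ) :
    Function.update (encUnary k) k .one = encUnary (k + 1) := by
  funext l
  by_cases hl : l = k
  · subst hl; simp [encUnary]
  · rw [Function.update_of_ne hl]
    simp only [encUnary]
    by_cases h : l < k
    · rw [if_pos h, if_pos (by omega)]
    · rw [if_neg h, if_neg (by omega)]

theorem encUnary_of_lt {l k : ℕ} (h : l < k) : encUnary k l = .one := if_pos h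

theorem encUnary_of_ge {l k : ℕ} (h : k ≤ l) : encUnary k l = .blank := if_neg (by omega)

theorem encPort_blank {out : Option ℕ} {k : ℕ} (h : ∀ p ∈ out, p < k) :
    ∀ l ≥ k, encPort out l = .blank := by
  intro l hl
  cases out with
  | none => exact encUnary_of_ge (by omega)
  | some p => exact encUnary_of_ge (by have := h p rfl; omega)

theorem leads_write_zero (x : Bits m) (out : Option ℕ) (k : ℕ) (h4 : ∀ p ∈ out, p < k) :
    ∃ h < m, ∃ k', Leads f hm
      (conf (.write ⟨0, hm⟩ x) ![encBits u, encBits w, t2, t3, encPort out] 0 k) m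
        (conf .final ![encBits x.1, encBits x.2, t2, t3, encPort out] h k') := by
  obtain ⟨h, hh, H⟩ := leads_write (f := f) (hm := hm) t2 t3 x (encPort out) (m - 1) ⟨0, hm⟩
    (encBits u) (encBits w) k (by simp; omega) (by simp) (fun l hl => by
      simp [encBits, Nat.not_lt.2 hl]) (encPort_blank h4)
  rw [Nat.sub_add_cancel hm] at H
  exact ⟨h, hh, _, H⟩

/-- Copying the incoming port. -/
theorem leads_copy {d : Verdict (Bits m)} {p : ℕ}
    (hd : (∃ a, d = .back a) ∨ ∃ a b, d = .next a b) {n : ℕ} {z : TMConf (State m)}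
    (H : Leads f hm (conf (.port d) ![encBits u, encBits w, t2, encPort (some p), encUnary (p + 1)]
      0 (p + 1)) n z) (j : ℕ) :
    ∀ k, k + j = p + 1 →
      Leads f hm (conf (.port d) ![encBits u, encBits w, t2, encPort (some p), encUnary k] 0 k)
        (n + j) z := by
  induction j with
  | zero =>
    intro k hk
    obtain rfl : k = p + 1 := by omega
    exact H
  | succ j ih =>
    intro k hk
    have h3 : encPort (some p) k = .one := encUnary_of_lt (by omega)
    rw [← Nat.add_assoc]
    refine Leads.single (e := ⟨.port d, encBits u 0, encBits w 0, .one, .left, .right⟩)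
      _ _ _ _ _ _ (by simp) hm ?_ ?_
    · rcases hd with ⟨a, rfl⟩ | ⟨a, b, rfl⟩ <;> simp [effect, hm, h3, isOne]
    · simp only [HeadDir.shift, Function.update_eq_self, update_encUnary]
      exact ih (k + 1) (by omega)

theorem leads_port {d : Verdict (Bits m)} {deg : ℕ} {pin : Option ℕ} {x : Bits m}
    {out : Option ℕ} (hd : d.Yields deg pin x out) (hpin : ∀ p ∈ pin, p < deg) :
    ∃ n ≤ m + deg + 1, ∃ h < m, ∃ k, Leads f hm
      (conf (.port d) ![encBits u, encBits w, encUnary deg, encPort pin, encUnary 0] 0 0) n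
        (conf .final ![encBits x.1, encBits x.2, encUnary deg, encPort pin, encPort out] h k) := by
  cases hd with
  | halt =>
    obtain ⟨h, hh, k, H⟩ := leads_write_zero (f := f) (hm := hm) u w (encUnary deg)
      (encPort pin) x none 1 (by simp)
    refine ⟨m + 1, by omega, h, hh, k, ?_⟩
    refine Leads.single _ _ _ _ _ _ (by simp) hm (by simp only [effect, dif_pos hm]; rfl) ?_
    simp only [HeadDir.shift, Function.update_eq_self]
    rw [update_of_eq (encUnary_of_ge le_rfl)]
    exact H
  | zero =>
    obtain ⟨h, hh, k, H⟩ := leads_write_zero (f := f) (hm := hm) u w (encUnary deg)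
      (encPort pin) x (some 0) 1 (by simp)
    refine ⟨m + 1, by omega, h, hh, k, ?_⟩
    refine Leads.single _ _ _ _ _ _ (by simp) hm (by simp only [effect, dif_pos hm]; rfl) ?_
    simp only [HeadDir.shift, Function.update_eq_self, update_encUnary]
    exact H
  | back p =>
    have hp := hpin p rfl
    obtain ⟨h, hh, k, H⟩ := leads_write_zero (f := f) (hm := hm) u w (encUnary deg)
      (encPort (some p)) x (some p) (p + 2) (by simp)
    refine ⟨m + 1 + (p + 1), by omega, h, hh, k, ?_⟩
    refine leads_copy u w _ (.inl ⟨_, rfl⟩) ?_ (p + 1) 0 (by omega)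
    have h3 : encPort (some p) (p + 1) = .blank := encUnary_of_ge le_rfl
    refine Leads.single _ _ _ _ _ _ (by simp) hm
      (by simp only [effect, dif_pos hm, h3, isOne, Bool.false_eq_true, if_false]; rfl) ?_
    simp only [HeadDir.shift, Function.update_eq_self]
    rw [update_of_eq (encUnary_of_ge le_rfl)]
    exact H
  | next p _ b hlt =>
    have hp := hpin p rfl
    obtain ⟨h, hh, k, H⟩ := leads_write_zero (f := f) (hm := hm) u w (encUnary deg)
      (encPort (some p)) x (some (p + 1)) (p + 2) (by simp)
    refine ⟨m + 1 + (p + 1), by omega, h, hh, k, ?_⟩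
    refine leads_copy u w _ (.inr ⟨_, _, rfl⟩) ?_ (p + 1) 0 (by omega)
    have h3 : encPort (some p) (p + 1) = .blank := encUnary_of_ge le_rfl
    -- After `p + 1` ones have been copied, the heads stand on cell `p + 1`, and the degree tape
    -- holds a one there exactly when port `p + 1` exists.
    have h2 : encUnary deg (p + 1) = .one := encUnary_of_lt hlt
    refine Leads.single _ _ _ _ _ _ (by simp) hm
      (by simp only [effect, dif_pos hm, h3, h2, isOne, Bool.false_eq_true, if_false, if_true]
          rfl) ?_
    simp only [HeadDir.shift, Function.update_eq_self, update_encUnary]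
    exact H
  | last p a _ hge =>
    have hp := hpin p rfl
    obtain ⟨h, hh, k, H⟩ := leads_write_zero (f := f) (hm := hm) u w (encUnary deg)
      (encPort (some p)) x (some p) (p + 2) (by simp)
    refine ⟨m + 1 + (p + 1), by omega, h, hh, k, ?_⟩
    refine leads_copy u w _ (.inr ⟨_, _, rfl⟩) ?_ (p + 1) 0 (by omega)
    have h3 : encPort (some p) (p + 1) = .blank := encUnary_of_ge le_rfl
    have h2 : encUnary deg (p + 1) = .blank := encUnary_of_ge hge
    refine Leads.single _ _ _ _ _ _ (by simp) hm
      (by simp only [effect, dif_pos hm, h3, h2, isOne, Bool.false_eq_true, if_false]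
          rfl) ?_
    simp only [HeadDir.shift, Function.update_eq_self]
    rw [update_of_eq (encUnary_of_ge le_rfl)]
    exact H

/-- The tapes have no left end marker, so the machine counts left moves instead of looking for cell
`0`; superfluous moves leave the head on cell `0`. The bound `h + i < m` forces `h = 0` at the last
count. -/
theorem leads_rewind {deg n : ℕ} {z : TMConf (State m)}
    (H : Leads f hm (conf (.port (f (u, w) (decide (0 < deg))))
      ![encBits u, encBits w, encUnary deg, t3, encUnary 0] 0 0) n z) (j : ℕ) :
    ∀ (i : Fin m) (h : ℕ), i.1 + j + 1 = m → h + i.1 < m →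
      Leads f hm (conf (.rewind i (u, w))
        ![encBits u, encBits w, encUnary deg, t3, encUnary 0] h 0) (n + j + 1) z := by
  have hdeg : isOne (encUnary deg 0) = decide (0 < deg) := by
    by_cases h : 0 < deg
    · simp [encUnary, isOne, h]
    · simp [encUnary, isOne, h]
  induction j with
  | zero =>
    intro i h hi hh
    have hlast : ¬ i.1 + 1 < m := by omega
    obtain rfl : h = 0 := by omega
    refine Leads.single _ _ _ _ _ _ (by simp) hm (by simp only [effect, dif_neg hlast]; rfl) ?_
    simp only [HeadDir.shift, Function.update_eq_self, hdeg]
    rw [update_of_eq (encUnary_of_ge le_rfl)]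
    exact H
  | succ j ih =>
    intro i h hi hh
    have hlt : i.1 + 1 < m := by omega
    refine Leads.single _ _ _ _ _ _ (by simp) (by omega) (by simp only [effect, dif_pos hlt]; rfl) ?_
    simp only [HeadDir.shift, Function.update_eq_self]
    rw [update_of_eq (encUnary_of_ge le_rfl)]
    exact ih ⟨i.1 + 1, hlt⟩ (h - 1) (by simp; omega) (by simp; omega)

theorem leads_read {deg n : ℕ} {z : TMConf (State m)}
    (H : Leads f hm (conf (.rewind ⟨0, hm⟩ (u, w))
      ![encBits u, encBits w, encUnary deg, t3, encUnary 0] (m - 1 - 1) 0) n z) (j : ℕ) :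
    ∀ (i : Fin m) (x : Bits m), i.1 + j + 1 = m → (∀ l < i, x.1 l = u l ∧ x.2 l = w l) →
      Leads f hm (conf (.read i x)
        ![encBits u, encBits w, encUnary deg, t3, encUnary 0] i 0) (n + j + 1) z := by
  induction j with
  | zero =>
    intro i x hi hx
    have hlast : ¬ i.1 + 1 < m := by omega
    refine Leads.single _ _ _ _ _ _ (by simp) i.2 (by simp only [effect, dif_neg hlast]; rfl) ?_
    simp only [HeadDir.shift, Function.update_eq_self, isOne_encBits]
    rw [update_of_eq (encUnary_of_ge le_rfl), show i.1 = m - 1 by omega]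
    have key : ∀ (a b : Fin m → Bool), (∀ l < i, a l = b l) → Function.update a i (b i) = b := by
      intro a b hab
      funext l
      by_cases hl : l = i
      · subst hl; simp
      · rw [Function.update_of_ne hl]
        exact hab l (by
          have : l.1 ≠ i.1 := fun h => hl (Fin.ext h)
          exact Fin.lt_def.2 (by omega))
    rw [key _ _ (fun l hl => (hx l hl).1), key _ _ (fun l hl => (hx l hl).2)]
    exact H
  | succ j ih =>
    intro i x hi hx
    have hlt : i.1 + 1 < m := by omega
    refine Leads.single _ _ _ _ _ _ (by simp) i.2 (by simp only [effect, dif_pos hlt]; rfl) ?_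
    simp only [HeadDir.shift, Function.update_eq_self, isOne_encBits]
    rw [update_of_eq (encUnary_of_ge le_rfl)]
    refine ih ⟨i.1 + 1, hlt⟩ _ (by simp; omega) (fun l hl => ?_)
    by_cases hli : l = i
    · subst hli; simp
    · simp only [Function.update_of_ne hli]
      refine hx l (Fin.lt_def.2 ?_)
      have h1 : l.1 ≠ i.1 := fun h => hli (Fin.ext h)
      have h2 : l.1 < i.1 + 1 := hl
      omega

theorem computes (x : Bits m) {deg : ℕ} {pin : Option ℕ} {y : Bits m} {out : Option ℕ}
    (hd : (f x (decide (0 < deg))).Yields deg pin y out) (hpin : ∀ p ∈ pin, p < deg) :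
    ∃ τ ≤ 3 * m + deg + 1,
      (machine f hm).Computes x.1 x.2 deg pin τ y.1 y.2 out := by
  obtain ⟨u, w⟩ := x
  obtain ⟨n, hn, h, hh, k, H⟩ := leads_port (f := f) (hm := hm) u w hd hpin
  -- The last reading step, on cell `m - 1`, already moves left, so rewinding starts at `m - 1 - 1`
  -- (which is `0` for `m = 1`). Reading and rewinding take `m` steps each.
  have H1 := leads_rewind u w _ H (m - 1) ⟨0, hm⟩ (m - 1 - 1) (by simp; omega) (by simp; omega)
  have H2 := leads_read u w _ H1 (m - 1) ⟨0, hm⟩ (fun _ => false, fun _ => false)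
    (by simp; omega) (fun l hl => absurd (Fin.lt_def.1 hl) (by simp))
  refine ⟨n + (m - 1) + 1 + (m - 1) + 1, by omega, ?_⟩
  · obtain ⟨hfin, hrun⟩ := H2
    have hinit : (machine f hm).initial u w deg pin =
        conf (.read ⟨0, hm⟩ (fun _ => false, fun _ => false))
          ![encBits u, encBits w, encUnary deg, encPort pin, encUnary 0] 0 0 := by
      simp only [AgentMachine.initial, conf]
      congr 1
      funext i
      fin_cases i <;> rfl
    rw [← hinit] at hfin hrun
    refine ⟨fun i hi => (hrun i hi).1, ?_, fun i hi => ?_, ?_, ?_, ?_⟩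
    · dsimp only
      rw [hfin]; rfl
    · rcases hi.lt_or_eq with hi | rfl
      · exact (hrun i hi).2
      · dsimp only
        rw [hfin]
        exact ⟨hh, hh⟩
    all_goals dsimp only; rw [hfin]; rfl

end RuleMachine

/-! ## The grey path of Lex-DFS -/

namespace PortGraph

variable {V : Type u} (G : PortGraph V)

/-- The invariant of Lex-DFS. In `least`, `f` is the node after `v` on the grey path: its port at `v`
is minimal not only among the later nodes of the path but also among the white nodes. -/
structure IsRegular (r : V) (S : DFSState V) : Prop where
  nodup : S.stack.Nodup
  grey : ∀ v, S.colour v = Colour.grey ↔ v ∈ S.stack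
  root : ∀ u ∈ S.stack.getLast?, u = r
  least : ∀ (F : List V) (f v : V) (A : List V), S.stack = F ++ f :: v :: A →
    ∃ h : G.graph.Adj v f, ∀ (x : V) (hx : G.graph.Adj v x), x ∈ F ∨ S.colour x = Colour.white →
      G.portNum h ≤ G.portNum hx

variable {G} {r : V}

theorem isRegular_initial : G.IsRegular r (DFSState.initial V) where
  nodup := List.nodup_nil
  grey v := by simp [DFSState.initial]
  root u hu := by simp [DFSState.initial] at hu
  least F f v A h := by simp [DFSState.initial] at h

/-- The stack is the reversed grey path, so the nodes from index `i + 2` on form the list `F` of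
`IsRegular.least`. -/
theorem IsRegular.greyPathProperty {S : DFSState V} (h : G.IsRegular r S) :
    G.GreyPathProperty r S := by
  refine ⟨fun u hu => h.root u ?_, fun v => ?_, fun i hi => ?_⟩
  · simpa [DFSState.greyPath, List.head?_reverse] using hu
  · simpa [DFSState.greyPath] using h.grey v
  · set p := S.greyPath with hp
    have hsplit : p = p.take i ++ p[i] :: p[i + 1] :: p.drop (i + 2) := by
      rw [← List.drop_eq_getElem_cons hi, ← List.drop_eq_getElem_cons (by omega),
        List.take_append_drop]
    have hstack : S.stack = (p.drop (i + 2)).reverse ++ p[i + 1] :: p[i] :: (p.take i).reverse := by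
      have : S.stack = p.reverse := by simp [hp, DFSState.greyPath]
      rw [this]
      conv_lhs => rw [hsplit]
      simp
    obtain ⟨hadj, hle⟩ := h.least _ _ _ _ hstack
    refine ⟨hadj, ⟨i + 1, hi, hadj, le_rfl, rfl⟩, ?_⟩
    rintro _ ⟨j, hj, hij, hle', rfl⟩
    rcases hle'.eq_or_lt with rfl | hlt
    · exact le_rfl
    · refine hle _ hij (.inl ?_)
      have hj' : j < p.length := hj
      rw [List.mem_reverse, List.mem_iff_getElem]
      exact ⟨j - (i + 2), by simp only [List.length_drop]; omega,
        by simp only [List.getElem_drop, show i + 2 + (j - (i + 2)) = j by omega]; rfl⟩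

variable [DecidableEq V]

/-- For a pair of consecutive nodes that survives the move, the nodes considered in `least` do not
increase: a discovered node passes from the white ones to `F`, and a finished one leaves `F` and is
black. For the pair created by a discovery, `least` is the choice rule of the search. -/
theorem LexMove.isRegular {S S' : DFSState V} (hm : G.LexMove r S S') (h : G.IsRegular r S) :
    G.IsRegular r S' := by
  cases hm with
  | start =>
    refine ⟨List.nodup_singleton r, fun v => ?_, fun u hu => ?_, fun F f v A h => ?_⟩
    · by_cases hv : v = r
      · subst hv; simp
      · simp [hv, DFSState.initial]
    · simpa [eq_comm] using hu
    · have := congrArg List.length h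
      simp at this
      omega
  | forward v w rest col hadj hw hmin =>
    have hws : w ∉ v :: rest := fun hmem => by
      have := (h.grey w).2 hmem
      simp [hw] at this
    refine ⟨List.nodup_cons.2 ⟨hws, h.nodup⟩, fun x => ?_, fun u hu => ?_, fun F f x A hs => ?_⟩
    · by_cases hx : x = w
      · subst hx; simp
      · simp only [Function.update_of_ne hx, List.mem_cons (a := x) (b := w), hx, false_or]
        exact h.grey x
    · exact h.root u (by simpa [List.getLast?_cons_cons] using hu)
    · have hwhite : ∀ y, Function.update col w Colour.grey y = Colour.white → col y = .white := by
        intro y hy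
        by_cases hyw : y = w
        · subst hyw; simp at hy
        · rwa [Function.update_of_ne hyw] at hy
      cases F with
      | nil =>
        obtain ⟨rfl, rfl, rfl⟩ : w = f ∧ v = x ∧ rest = A := by simpa using hs
        refine ⟨hadj, fun y hy hyw => ?_⟩
        rcases hyw with hyw | hyw
        · simp at hyw
        · exact hmin y hy (hwhite y hyw)
      | cons a F =>
        obtain ⟨rfl, hs'⟩ : w = a ∧ v :: rest = F ++ f :: x :: A := by simpa using hs
        obtain ⟨hf, hle⟩ := h.least F f x A hs'
        refine ⟨hf, fun y hy hyw => hle y hy ?_⟩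
        rcases hyw with hyw | hyw
        · rcases List.mem_cons.1 hyw with rfl | hyw
          · exact .inr hw
          · exact .inl hyw
        · exact .inr (hwhite y hyw)
  | back v rest col hv =>
    have hnd : v ∉ rest ∧ rest.Nodup := List.nodup_cons.1 h.nodup
    refine ⟨hnd.2, fun x => ?_, fun u hu => ?_, fun F f x A hs => ?_⟩
    · by_cases hx : x = v
      · subst hx; simp [hnd.1]
      · have := h.grey x
        simp only [List.mem_cons, hx, false_or] at this
        simpa [Function.update_of_ne hx] using this
    · refine h.root u ?_
      cases rest with
      | nil => simp at hu
      | cons a rest => simpa [List.getLast?_cons_cons] using hu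
    · obtain ⟨hf, hle⟩ := h.least (v :: F) f x A (by simpa using hs)
      refine ⟨hf, fun y hy hyw => hle y hy ?_⟩
      rcases hyw with hyw | hyw
      · exact .inl (List.mem_cons_of_mem _ hyw)
      · refine .inr ?_
        by_cases hyv : y = v
        · subst hyv; simp at hyw
        · simpa [Function.update_of_ne hyv] using hyw

theorem isRegular_of_reflTransGen {S : DFSState V}
    (h : Relation.ReflTransGen (G.LexMove r) (DFSState.initial V) S) : G.IsRegular r S := by
  induction h with
  | refl => exact isRegular_initial
  | tail _ hm ih => exact hm.isRegular ih

end PortGraph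

/-! ## Agents with abstract modes and labels -/

/-- One-hot encoding, except that `a₀` becomes the zero string, since all bits are zero at the
start. It works for all large `m`, so modes and labels can share one length. -/
theorem exists_bitEncoding (α : Type) [Finite α] (a₀ : α) :
    ∃ N, ∀ m ≥ N, ∃ e : α → Fin m → Bool, Function.Injective e ∧ e a₀ = fun _ => false := by
  classical
  obtain ⟨N, ⟨idx⟩⟩ := Finite.exists_equiv_fin α
  refine ⟨N, fun m hm => ⟨fun a i => decide (i.1 = (idx a).1 ∧ a ≠ a₀), fun a b hab => ?_, ?_⟩⟩
  · have key : ∀ {a b : α}, (∀ i : Fin m, decide (i.1 = (idx a).1 ∧ a ≠ a₀) =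
        decide (i.1 = (idx b).1 ∧ b ≠ a₀)) → a ≠ a₀ → a = b := by
      intro a b h ha
      have := h ⟨(idx a).1, (idx a).2.trans_le hm⟩
      simp only [ha, ne_eq, not_false_eq_true, and_self, decide_true, true_eq_decide_iff] at this
      exact idx.injective (Fin.ext this.1)
    by_cases ha : a = a₀
    · by_cases hb : b = a₀
      · rw [ha, hb]
      · exact (key (fun i => (congrFun hab i).symm) hb).symm
    · exact key (fun i => congrFun hab i) ha
  · funext i
    simp

/-- The sequence `a, f 0, f 1, …`. -/
def prependSeq {α : Type*} (a : α) (f : ℕ → α) : ℕ → α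
  | 0 => a
  | t + 1 => f t

/-- A configuration of an agent whose memory holds a mode, on nodes whose storage holds a label. -/
structure LabelConf (V : Type u) (A B : Type) where
  loc : V
  pin : Option ℕ
  mode : A
  lab : V → B

namespace PortGraph

variable {V : Type u} (G : PortGraph V)

theorem portNum_lt {v w : V} (h : G.graph.Adj v w) : G.portNum h < G.deg v :=
  (G.port v ⟨w, h⟩).2

theorem nbr_port {v w : V} (h : G.graph.Adj v w) : G.nbr v (G.port v ⟨w, h⟩) = w := by
  simp [nbr]

theorem portNum_nbr {v : V} (p : Fin (G.deg v)) : G.portNum (G.adj_nbr v p) = p := by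
  have : (⟨G.nbr v p, G.adj_nbr v p⟩ : G.graph.neighborSet v) = (G.port v).symm p := rfl
  simp [portNum, this]

theorem deg_le_card [Fintype V] (v : V) : G.deg v ≤ Fintype.card V := by
  have := Fintype.card_le_of_injective (G.nbr v) (fun p q h =>
    (G.port v).symm.injective (Subtype.ext h))
  simpa using this

variable [DecidableEq V]

/-- How an agent step at `l` may relate to the search: it makes at most one move. The truth value
says whether an agent step at the search head of the current state has been found. -/
def GhostStep (r l : V) (S : DFSState V) (att : Prop) (S' : DFSState V) (att' : Prop) : Prop :=
  (S' = S ∧ (att' → att ∨ l ∈ S.stack.head?)) ∨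
  (G.LexMove r S S' ∧ (att' → l ∈ S'.stack.head?) ∧ ∀ u ∈ S.stack.head?, att ∨ l = u)

variable {A B : Type} (rule : A → B → Bool → Verdict (A × B)) (colour : B → Colour) (r : V)

/-- Within `N` steps, the agent that follows `rule` completes Lex-DFS from the state `S` and terminates.
If `att` holds then no agent step at the search head of `S` is needed any more. -/
inductive Completes : LabelConf V A B → DFSState V → Prop → ℕ → Prop
  | halt {a : LabelConf V A B} {S : DFSState V} {att : Prop} {N : ℕ} (mode : A) (l : B)
      (hpin : ∀ p ∈ a.pin, p < G.deg a.loc)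
      (hrule : (rule a.mode (a.lab a.loc) (decide (0 < G.deg a.loc))).Yields (G.deg a.loc) a.pin
        (mode, l) none)
      (hcol : ∀ v, colour (a.lab v) = S.colour v) (hl : colour l = colour (a.lab a.loc))
      (hstack : S.stack = []) (hend : ∀ S', ¬ G.LexMove r S S') :
      Completes a S att (N + 1)
  | move {a : LabelConf V A B} {S S' : DFSState V} {att att' : Prop} {N : ℕ} (mode : A) (l : B)
      (p : Fin (G.deg a.loc)) (hpin : ∀ p ∈ a.pin, p < G.deg a.loc)
      (hrule : (rule a.mode (a.lab a.loc) (decide (0 < G.deg a.loc))).Yields (G.deg a.loc) a.pin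
        (mode, l) (some p))
      (hcol : ∀ v, colour (a.lab v) = S.colour v)
      (hghost : G.GhostStep r a.loc S att S' att')
      (hnext : Completes ⟨G.nbr a.loc p, some (G.portNum (G.adj_nbr a.loc p).symm), mode,
        Function.update a.lab a.loc l⟩ S' att' N) :
      Completes a S att (N + 1)

variable {G rule colour r}

theorem Completes.mono {a : LabelConf V A B} {S : DFSState V} {att : Prop} {N N' : ℕ}
    (h : G.Completes rule colour r a S att N) (hN : N ≤ N') :
    G.Completes rule colour r a S att N' := by
  induction h generalizing N' with
  | halt mode l hpin hrule hcol hl hstack hend =>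
    obtain ⟨N', rfl⟩ := Nat.exists_eq_add_of_le hN
    rw [Nat.add_right_comm]
    exact .halt mode l hpin hrule hcol hl hstack hend
  | move mode l p hpin hrule hcol hghost _ ih =>
    obtain ⟨N', rfl⟩ := Nat.exists_eq_add_of_le hN
    rw [Nat.add_right_comm]
    exact .move mode l p hpin hrule hcol hghost (ih (Nat.le_add_right _ _))

/-! ### From modes and labels to bits and machine executions -/

section Encoding

variable {m : ℕ} (eA : A → Fin m → Bool) (eB : B → Fin m → Bool)

def encodeConf (a : LabelConf V A B) : AgentConf V m m where
  loc := a.loc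
  pin := a.pin
  mem := eA a.mode
  sto := fun v => eB (a.lab v)

variable (rule) in
/-- The rule on bit strings. -/
noncomputable def bitRule [Nonempty A] [Nonempty B] (x : RuleMachine.Bits m) (b : Bool) :
    Verdict (RuleMachine.Bits m) :=
  (rule (Function.invFun eA x.1) (Function.invFun eB x.2) b).map (Prod.map eA eB)

variable [Nonempty A] [Nonempty B] (hm : 0 < m) {eA eB}

theorem computes_bitRule (hA : Function.Injective eA) (hB : Function.Injective eB) {a : A} {b : B}
    {deg : ℕ} {pin : Option ℕ} {y : A × B} {out : Option ℕ}
    (h : (rule a b (decide (0 < deg))).Yields deg pin y out) (hpin : ∀ p ∈ pin, p < deg) :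
    ∃ τ ≤ 3 * m + deg + 1, (RuleMachine.machine (bitRule rule eA eB) hm).Computes (eA a) (eB b)
      deg pin τ (eA y.1) (eB y.2) out := by
  refine RuleMachine.computes (eA a, eB b) (y := (eA y.1, eB y.2)) ?_ hpin
  simp only [bitRule, Function.leftInverse_invFun hA a, Function.leftInverse_invFun hB b]
  exact h.map (Prod.map eA eB)

omit [Nonempty A] [Nonempty B] in
theorem encodeConf_update (lab : V → B) (v : V) (l : B) :
    Function.update (fun w => eB (lab w)) v (eB l) = fun w => eB (Function.update lab v l w) := by
  funext w
  by_cases h : w = v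
  · subst h; simp
  · simp [Function.update_of_ne h]

/-- Induction along `Completes`, prepending the first agent step to the run obtained for the rest.
The alternative `k = 0 ∧ att` leaves open the visit to the search head of the first state, which an
earlier agent step has already made when `att` holds. -/
theorem Completes.exists_execution [Fintype V] (hA : Function.Injective eA)
    (hB : Function.Injective eB) {a : LabelConf V A B} {S : DFSState V} {att : Prop} {N : ℕ}
    (h : G.Completes rule colour r a S att N) :
    ∃ (T : ℕ) (conf : ℕ → AgentConf V m m) (time : ℕ → ℕ) (L : ℕ) (D : ℕ → DFSState V)
      (κ : ℕ → ℕ),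
      conf 0 = encodeConf eA eB a ∧ T + 1 ≤ N ∧
      (∀ t ≤ T, time t ≤ 3 * m + Fintype.card V + 1) ∧
      (∀ t < T, G.MoveStep (RuleMachine.machine (bitRule rule eA eB) hm) (time t) (conf t)
        (conf (t + 1))) ∧
      G.HaltStep (RuleMachine.machine (bitRule rule eA eB) hm) (time T) (conf T) (conf (T + 1)) ∧
      D 0 = S ∧ (∀ k < L, G.LexMove r (D k) (D (k + 1))) ∧ (∀ S', ¬ G.LexMove r (D L) S') ∧
      Monotone κ ∧ κ 0 = 0 ∧ κ (T + 1) = L ∧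
      (∀ t ≤ T + 1, ∀ v, colour (Function.invFun eB ((conf t).sto v)) = (D (κ t)).colour v) ∧
      ∀ k ≤ L, ∀ u ∈ (D k).stack.head?, (k = 0 ∧ att) ∨
        ∃ t ≤ T, κ t ≤ k ∧ k ≤ κ (t + 1) ∧ (conf t).loc = u := by
  have hdec : ∀ b, Function.invFun eB (eB b) = b := Function.leftInverse_invFun hB
  induction h with
  | @halt a S att N mode l hpin hrule hcol hl hstack hend =>
    obtain ⟨τ, hτ, hc⟩ := computes_bitRule hm hA hB hrule hpin
    have hdeg := G.deg_le_card a.loc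
    refine ⟨0, prependSeq (encodeConf eA eB a) (fun _ => encodeConf eA eB
      ⟨a.loc, a.pin, mode, Function.update a.lab a.loc l⟩), fun _ => τ, 0, fun _ => S, fun _ => 0,
      rfl, by omega, fun _ _ => hτ.trans (by omega), fun t ht => by omega, ⟨_, _, hc, ?_⟩, rfl,
      fun k hk => by omega, hend, monotone_const, rfl, rfl, fun t ht v => ?_, fun k _ u hu => ?_⟩
    · simp only [prependSeq, encodeConf, encodeConf_update]
    · rcases t with - | t
      · simp only [prependSeq, encodeConf, hdec, hcol]
      · simp only [prependSeq, encodeConf, hdec]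
        by_cases hv : v = a.loc
        · subst hv; simp [hl, hcol]
        · simp [Function.update_of_ne hv, hcol]
    · simp [hstack] at hu
  | @move a S S' att att' N mode l p hpin hrule hcol hghost _ ih =>
    obtain ⟨T, conf, time, L, D, κ, h0, hT, htime, hmove, hhalt, hD0, hD, hend, hmono, hκ0, hκT,
      hcols, hatt⟩ := ih
    obtain ⟨τ, hτ, hc⟩ := computes_bitRule hm hA hB hrule hpin
    have hdeg := G.deg_le_card a.loc
    have hfirst : G.MoveStep (RuleMachine.machine (bitRule rule eA eB) hm) τ
        (encodeConf eA eB a) (conf 0) := by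
      refine ⟨_, _, p, hc, ?_⟩
      rw [h0]
      simp only [encodeConf, encodeConf_update]
    have htime' : ∀ t ≤ T + 1, prependSeq τ time t ≤ 3 * m + Fintype.card V + 1 := by
      intro t ht
      rcases t with - | t
      · simp only [prependSeq]; omega
      · exact htime t (by omega)
    have hmove' : ∀ t < T + 1, G.MoveStep (RuleMachine.machine (bitRule rule eA eB) hm)
        (prependSeq τ time t) (prependSeq (encodeConf eA eB a) conf t)
        (prependSeq (encodeConf eA eB a) conf (t + 1)) := by
      intro t ht
      rcases t with - | t
      · exact hfirst
      · exact hmove t (by omega)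
    rcases hghost with ⟨rfl, hg⟩ | ⟨hlex, hg1, hg2⟩
    -- The agent step makes no search move: the run of the search is unchanged and `κ` repeats its
    -- value `0`.
    · refine ⟨T + 1, prependSeq (encodeConf eA eB a) conf, prependSeq τ time, L, D,
        prependSeq 0 κ, rfl, by omega, htime', hmove', hhalt, hD0, hD, hend, ?_, rfl, hκT, ?_, ?_⟩
      · refine monotone_nat_of_le_succ fun t => ?_
        rcases t with - | t
        · exact Nat.zero_le _
        · exact hmono (Nat.le_succ t)
      · intro t ht v
        rcases t with - | t
        · simp only [prependSeq, encodeConf, hdec, hD0, hcol]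
        · exact hcols t (by omega) v
      · intro k hk u hu
        rcases hatt k hk u hu with ⟨rfl, ha⟩ | ⟨t, ht, h1, h2, h3⟩
        · rcases hg ha with ha | ha
          · exact .inl ⟨rfl, ha⟩
          · refine .inr ⟨0, Nat.zero_le _, le_rfl, Nat.zero_le _, ?_⟩
            rw [hD0] at hu
            exact Option.mem_unique ha hu
        · exact .inr ⟨t + 1, by omega, h1, h2, h3⟩
    -- The agent step makes one search move: the state `S` is put in front of the run and the later
    -- values of `κ` grow by one.
    · refine ⟨T + 1, prependSeq (encodeConf eA eB a) conf, prependSeq τ time, L + 1,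
        prependSeq S D, prependSeq 0 (fun t => κ t + 1), rfl, by omega, htime', hmove', hhalt, rfl,
        ?_, hend, ?_, rfl, by simp [prependSeq, hκT], ?_, ?_⟩
      · intro k hk
        rcases k with - | k
        · simpa only [prependSeq, hD0] using hlex
        · exact hD k (by omega)
      · refine monotone_nat_of_le_succ fun t => ?_
        rcases t with - | t
        · exact Nat.zero_le _
        · exact Nat.succ_le_succ (hmono (Nat.le_succ t))
      · intro t ht v
        rcases t with - | t
        · simp only [prependSeq, encodeConf, hdec, hcol]
        · exact hcols t (by omega) v
      · intro k hk u hu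
        rcases k with - | k
        · rcases hg2 u hu with ha | ha
          · exact .inl ⟨rfl, ha⟩
          · exact .inr ⟨0, Nat.zero_le _, le_rfl, Nat.zero_le _, ha⟩
        · rcases hatt k (by omega) u hu with ⟨rfl, ha⟩ | ⟨t, ht, h1, h2, h3⟩
          · refine .inr ⟨0, Nat.zero_le _, Nat.zero_le _, by simp [prependSeq], ?_⟩
            have hu' : u ∈ S'.stack.head? := by simpa only [prependSeq, hD0] using hu
            exact Option.mem_unique (hg1 ha) hu'
          · exact .inr ⟨t + 1, by omega, Nat.succ_le_succ h1, Nat.succ_le_succ h2, h3⟩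

end Encoding

end PortGraph

/-! ## The rule of the agent

The agent remembers a kind of action, a scan, and a bit. A scan at a node `v` gives `v` a new label and then
visits the neighbours of `v`, in the order of the ports, until a certain label is found. No port has to be
remembered for this: the agent returns from a neighbour through the port by which it
came, and finds the next port from the port by which it comes back.

The agent finds the next node of the grey path as in `IsRegular.least`; the nodes already
found in the current round carry the current bit. To return to the root, it keeps an induced path from
the root to the last node found: the marks are `inner` on the path, except for its end, which is
marked `tail`. A node that is about to be appended to the path is marked `target`. -/

namespace LexAgent

inductive Mark where
  | none | inner | tail | target
  deriving DecidableEq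

inductive Label where
  | white | black | grey (bit : Bool) (mark : Mark)
  deriving DecidableEq

/-- `advance` looks for the next old node of the grey path, `discover` for a white node. `finish`
blackens the search head, and `retreat` walks back along the marked path, erasing it. The others
append a target `t`: `probe` asks whether `t` has an `inner` neighbour; if not, `attach` makes `t`
the new tail; if so, `toTail` goes to the tail, `cut` removes it, and `touch` asks whether the new
tail is adjacent to `t`. `done` means termination. -/
inductive Scan where
  | advance | discover | finish | retreat | probe | toTail | attach | cut | touch | done
  deriving DecidableEq

/-- `start`: about to begin a scan at its centre; `visit`: at a neighbour; `ret`: back at the centre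
after a miss; `bounce`: at the last neighbour once more, after all have been missed. -/
inductive Kind where
  | start | visit | ret | bounce

structure Mode where
  kind : Kind
  scan : Scan
  bit : Bool

instance : Finite Mark :=
  Finite.of_surjective (fun i : Fin 4 => ![Mark.none, .inner, .tail, .target] i) (by
    rintro (_ | _ | _ | _)
    exacts [⟨0, rfl⟩, ⟨1, rfl⟩, ⟨2, rfl⟩, ⟨3, rfl⟩])

instance : Finite Label :=
  Finite.of_surjective (fun x : Option (Option (Bool × Mark)) => match x with
    | none => Label.white
    | some none => .black
    | some (some (b, k)) => .grey b k) (by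
    rintro (_ | _ | ⟨b, k⟩)
    exacts [⟨none, rfl⟩, ⟨some none, rfl⟩, ⟨some (some (b, k)), rfl⟩])

instance : Finite Scan :=
  Finite.of_surjective (fun i : Fin 10 => ![Scan.advance, .discover, .finish, .retreat, .probe,
    .toTail, .attach, .cut, .touch, .done] i) (by
    rintro (_ | _ | _ | _ | _ | _ | _ | _ | _ | _)
    exacts [⟨0, rfl⟩, ⟨1, rfl⟩, ⟨2, rfl⟩, ⟨3, rfl⟩, ⟨4, rfl⟩, ⟨5, rfl⟩, ⟨6, rfl⟩, ⟨7, rfl⟩, ⟨8, rfl⟩,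
      ⟨9, rfl⟩])

instance : Finite Kind :=
  Finite.of_surjective (fun i : Fin 4 => ![Kind.start, .visit, .ret, .bounce] i) (by
    rintro (_ | _ | _ | _)
    exacts [⟨0, rfl⟩, ⟨1, rfl⟩, ⟨2, rfl⟩, ⟨3, rfl⟩])

instance : Finite Mode :=
  Finite.of_surjective (fun x : Kind × Scan × Bool => Mode.mk x.1 x.2.1 x.2.2) (by
    rintro ⟨k, q, b⟩
    exact ⟨(k, q, b), rfl⟩)

namespace Label

def colour : Label → Colour
  | .white => .white
  | .black => .black
  | .grey _ _ => .grey

end Label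

namespace Scan

/-- The label written at the node where the scan starts. -/
def entry : Scan → Bool → Label
  | .advance, b => .grey b .tail
  | .discover, b => .grey b .tail
  | .finish, _ => .black
  | .retreat, b => .grey b .none
  | .probe, b => .grey b .target
  | .toTail, b => .grey b .target
  | .attach, b => .grey b .target
  | .cut, b => .grey b .none
  | .touch, b => .grey b .tail
  | .done, _ => .black

/-- The label that the scan looks for. -/
def goal : Scan → Bool → Label
  | .advance, b => .grey (!b) .none
  | .discover, _ => .white
  | .finish, b => .grey b .inner
  | .retreat, b => .grey b .inner
  | .probe, b => .grey b .inner
  | .toTail, b => .grey b .tail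
  | .attach, b => .grey b .tail
  | .cut, b => .grey b .inner
  | .touch, b => .grey b .target
  | .done, _ => .white

/-- Whether the agent returns from the neighbour that it has found. It then marks that
neighbour `inner`. -/
def returns : Scan → Bool
  | .probe => true
  | .attach => true
  | _ => false

/-- The next scan after the scan has been successful. -/
def found : Scan → Scan
  | .advance => .probe
  | .discover => .probe
  | .finish => .retreat
  | .retreat => .retreat
  | .probe => .toTail
  | .toTail => .cut
  | .attach => .advance
  | .cut => .touch
  | .touch => .probe
  | .done => .done

/-- The next scan after the scan has been unsuccessful. -/
def missed : Scan → Scan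
  | .advance => .discover
  | .discover => .finish
  | .retreat => .advance
  | .probe => .attach
  | .touch => .cut
  | _ => .done

/-- The bit after the scan has been unsuccessful. -/
def missedBit : Scan → Bool → Bool
  | .retreat, b => !b
  | _, b => b

theorem colour_of_returns {q : Scan} {b : Bool} (h : q.returns = true) :
    (q.goal b).colour = .grey := by
  cases q <;> simp_all [returns, goal, Label.colour]

end Scan

/-- A scan that has run out of ports is noticed only at the centre, in a computation that must leave
by the incoming port. The bounce brings the agent back to the centre to start the next scan there. A
start at degree `0` occurs only on a graph with one node. -/
def rule : Mode → Label → Bool → Verdict (Mode × Label)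
  | ⟨.start, q, b⟩, l, positive =>
    if q = .done then .halt (⟨.start, q, b⟩, l)
    else if positive then .zero (⟨.visit, q, b⟩, q.entry b)
    else .halt (⟨.start, q, b⟩, .black)
  | ⟨.visit, q, b⟩, l, _ =>
    if l = q.goal b then
      if q.returns then .back (⟨.start, q.found, b⟩, .grey b .inner)
      else .zero (⟨.visit, q.found, b⟩, q.found.entry b)
    else .back (⟨.ret, q, b⟩, l)
  | ⟨.ret, q, b⟩, l, _ => .next (⟨.visit, q, b⟩, l) (⟨.bounce, q.missed, q.missedBit b⟩, l)
  | ⟨.bounce, q, b⟩, l, _ => .back (⟨.start, q, b⟩, l)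

end LexAgent

/-! ### The cost of a single scan -/

namespace PortGraph

open LexAgent

variable {V : Type u} (G : PortGraph V)

/-- The labels show the colours. -/
def Agrees (lab : V → Label) (S : DFSState V) : Prop := ∀ v, (lab v).colour = S.colour v

theorem portNum_injective {v w x : V} {h : G.graph.Adj v w} {h' : G.graph.Adj v x}
    (e : G.portNum h = G.portNum h') : w = x := by
  have := (G.port v).injective (Fin.ext e)
  exact congrArg Subtype.val this

theorem exists_port {v : V} {p : ℕ} (hp : p < G.deg v) :
    ∃ (w : V) (h : G.graph.Adj v w), G.portNum h = p :=
  ⟨_, G.adj_nbr v ⟨p, hp⟩, G.portNum_nbr ⟨p, hp⟩⟩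

/-- Among the neighbours with a certain property, there is one with the smallest port. -/
theorem exists_least_port {v : V} {P : V → Prop} (h : ∃ w, G.graph.Adj v w ∧ P w) :
    ∃ (w : V) (hw : G.graph.Adj v w), P w ∧
      ∀ (x : V) (hx : G.graph.Adj v x), P x → G.portNum hw ≤ G.portNum hx := by
  classical
  obtain ⟨w₀, hw₀, hP₀⟩ := h
  have hex : ∃ p, ∃ (w : V) (hw : G.graph.Adj v w), P w ∧ G.portNum hw = p :=
    ⟨_, w₀, hw₀, hP₀, rfl⟩
  obtain ⟨w, hw, hP, hp⟩ := Nat.find_spec hex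
  exact ⟨w, hw, hP, fun x hx hPx => hp ▸ Nat.find_min' hex ⟨x, hx, hPx, rfl⟩⟩

variable [DecidableEq V] {G} {r : V}

variable (G r) in
abbrev LexCompletes (a : LabelConf V Mode Label) (S : DFSState V) (att : Prop) (N : ℕ) : Prop :=
  G.Completes rule Label.colour r a S att N

theorem GhostStep.refl {l : V} {S : DFSState V} {att : Prop} : G.GhostStep r l S att S att :=
  .inl ⟨rfl, .inl⟩

theorem LexCompletes.step {v w : V} {pin : Option ℕ} {mode mode' : Mode} {lab : V → Label}
    {l : Label} {S S' : DFSState V} {att att' : Prop} {N : ℕ} (h : G.graph.Adj v w)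
    (hpin : ∀ p ∈ pin, p < G.deg v)
    (hrule : (rule mode (lab v) true).Yields (G.deg v) pin (mode', l) (some (G.portNum h)))
    (hcol : Agrees lab S) (hghost : G.GhostStep r v S att S' att')
    (hnext : G.LexCompletes r ⟨w, some (G.portNum h.symm), mode', Function.update lab v l⟩
      S' att' N) :
    G.LexCompletes r ⟨v, pin, mode, lab⟩ S att (N + 1) := by
  have hdeg : decide (0 < G.deg v) = true := by
    have := G.portNum_lt h
    simp only [decide_eq_true_eq]
    omega
  refine Completes.move mode' l (G.port v ⟨w, h⟩) hpin ?_ hcol hghost ?_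
  · simp only [hdeg]
    exact hrule
  · have key : ∀ (y : V) (hy : G.graph.Adj v y), y = w →
        G.LexCompletes r ⟨y, some (G.portNum hy.symm), mode', Function.update lab v l⟩ S' att' N := by
      rintro y hy rfl
      exact hnext
    exact key _ (G.adj_nbr v _) (G.nbr_port h)

variable (G r) in
/-- The agent visits the first neighbour in a scan at `v`. -/
def Scanning (q : Scan) (b : Bool) (v : V) (lab : V → Label) (S : DFSState V) (att : Prop)
    (N : ℕ) : Prop :=
  ∀ (w : V) (h : G.graph.Adj v w), G.portNum h = 0 →
    G.LexCompletes r ⟨w, some (G.portNum h.symm), ⟨.visit, q, b⟩, lab⟩ S att N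

theorem Scanning.mono {q : Scan} {b : Bool} {v : V} {lab : V → Label} {S : DFSState V} {att : Prop}
    {N N' : ℕ} (h : G.Scanning r q b v lab S att N) (hN : N ≤ N') :
    G.Scanning r q b v lab S att N' :=
  fun w hw h0 => (h w hw h0).mono hN

section

variable {q : Scan} {b : Bool} {v : V} {lab : V → Label} {S S' : DFSState V} {att att' : Prop}
  {N : ℕ}

theorem visit_missed {w : V} (h : G.graph.Adj v w) (hw : lab w ≠ q.goal b) (hcol : Agrees lab S)
    (H : G.LexCompletes r ⟨v, some (G.portNum h), ⟨.ret, q, b⟩, lab⟩ S att N) :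
    G.LexCompletes r ⟨w, some (G.portNum h.symm), ⟨.visit, q, b⟩, lab⟩ S att (N + 1) := by
  refine LexCompletes.step h.symm (by simpa using G.portNum_lt h.symm) (l := lab w)
    (mode' := ⟨.ret, q, b⟩) ?_ hcol .refl ?_
  · simp only [rule, if_neg hw]
    exact .back _ _
  · rwa [Function.update_eq_self]

/-- Each port before that of `w` costs two agent steps, back to `v` and on to the next neighbour.
The induction goes down from the port of `w` to port `0`. -/
theorem scanning_of_visit (hcol : Agrees lab S) {w : V} (h : G.graph.Adj v w)
    (hmiss : ∀ (x : V) (hx : G.graph.Adj v x), G.portNum hx < G.portNum h → lab x ≠ q.goal b)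
    (H : G.LexCompletes r ⟨w, some (G.portNum h.symm), ⟨.visit, q, b⟩, lab⟩ S att N) :
    G.Scanning r q b v lab S att (N + 2 * G.portNum h) := by
  obtain ⟨n, hn⟩ : ∃ n, G.portNum h = n := ⟨_, rfl⟩
  induction n generalizing w N with
  | zero =>
    intro w₀ h₀ hp
    obtain rfl := G.portNum_injective (hp.trans hn.symm)
    rwa [hp]
  | succ n ih =>
    obtain ⟨x, hx, hxn⟩ := G.exists_port (v := v) (p := n) (by have := G.portNum_lt h; omega)
    have H' : G.LexCompletes r ⟨x, some (G.portNum hx.symm), ⟨.visit, q, b⟩, lab⟩ S att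
        (N + 1 + 1) := by
      refine visit_missed hx (hmiss x hx (by omega)) hcol ?_
      refine LexCompletes.step h (by simpa using G.portNum_lt hx) (l := lab v)
        (mode' := ⟨.visit, q, b⟩) ?_ hcol .refl ?_
      · rw [hn, ← hxn]
        refine .next _ _ _ ?_
        have := G.portNum_lt h
        omega
      · rwa [Function.update_eq_self]
    refine (ih hx (fun y hy hlt => hmiss y hy (by omega)) H' hxn).mono (by omega)

theorem start_done (hcol : Agrees lab S) {p : ℕ} (hp : p < G.deg v) (hstack : S.stack = [])
    (hend : ∀ S', ¬ G.LexMove r S S') :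
    G.LexCompletes r ⟨v, some p, ⟨.start, .done, b⟩, lab⟩ S att 1 :=
  Completes.halt (N := 0) ⟨.start, .done, b⟩ (lab v) (by simpa using hp) (.halt _ _) hcol rfl
    hstack hend

theorem start_scan {pin : Option ℕ} (hpin : ∀ p ∈ pin, p < G.deg v) (hdeg : 0 < G.deg v)
    (hq : q ≠ .done) (hcol : Agrees lab S) (hghost : G.GhostStep r v S att S' att')
    (H : G.Scanning r q b v (Function.update lab v (q.entry b)) S' att' N) :
    G.LexCompletes r ⟨v, pin, ⟨.start, q, b⟩, lab⟩ S att (N + 1) := by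
  obtain ⟨w, h, h0⟩ := G.exists_port hdeg
  refine LexCompletes.step h hpin ?_ hcol hghost (H w h h0)
  simp only [rule, if_neg hq, if_true, h0]
  exact .zero _ _

/-- Beyond the `2 * (deg - 1)` steps that lead to the last neighbour, three more are needed: back to
`v`, out again as a bounce, and back. -/
theorem scanning_missed (hdeg : 0 < G.deg v) (hcol : Agrees lab S)
    (hmiss : ∀ x, G.graph.Adj v x → lab x ≠ q.goal b)
    (H : ∀ p < G.deg v, G.LexCompletes r ⟨v, some p, ⟨.start, q.missed, q.missedBit b⟩, lab⟩
      S att N) :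
    G.Scanning r q b v lab S att (N + 2 * G.deg v + 1) := by
  obtain ⟨w, h, hp⟩ := G.exists_port (v := v) (p := G.deg v - 1) (by omega)
  have H' : G.LexCompletes r ⟨w, some (G.portNum h.symm), ⟨.visit, q, b⟩, lab⟩ S att
      (N + 1 + 1 + 1) := by
    refine visit_missed h (hmiss w h) hcol ?_
    refine LexCompletes.step h (by simpa using G.portNum_lt h) (l := lab v)
      (mode' := ⟨.bounce, q.missed, q.missedBit b⟩) (.last _ _ _ (by omega)) hcol .refl ?_
    rw [Function.update_eq_self]
    refine LexCompletes.step h.symm (by simpa using G.portNum_lt h.symm) (l := lab w)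
      (mode' := ⟨.start, q.missed, q.missedBit b⟩) (.back _ _) hcol .refl ?_
    rw [Function.update_eq_self]
    exact H _ (G.portNum_lt h)
  exact (scanning_of_visit hcol h (fun x hx _ => hmiss x hx) H').mono (by omega)

variable [Fintype V]

theorem Scanning.miss (hdeg : 0 < G.deg v) (hcol : Agrees lab S)
    (hmiss : ∀ x, G.graph.Adj v x → lab x ≠ q.goal b) (hq : q.missed ≠ .done)
    (hghost : G.GhostStep r v S att S' att')
    (H : G.Scanning r q.missed (q.missedBit b) v
      (Function.update lab v (q.missed.entry (q.missedBit b))) S' att' N) :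
    G.Scanning r q b v lab S att (N + (2 * Fintype.card V + 2)) :=
  (scanning_missed hdeg hcol hmiss fun p hp =>
    start_scan (by simpa using hp) hdeg hq hcol hghost H).mono
      (by have := G.deg_le_card v; omega)

theorem Scanning.halt (hdeg : 0 < G.deg v) (hcol : Agrees lab S)
    (hmiss : ∀ x, G.graph.Adj v x → lab x ≠ q.goal b) (hq : q.missed = .done)
    (hstack : S.stack = []) (hend : ∀ S', ¬ G.LexMove r S S') :
    G.Scanning r q b v lab S att (2 * Fintype.card V + 2) :=
  (scanning_missed hdeg hcol hmiss fun p hp => by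
    rw [hq]
    exact start_done hcol hp hstack hend).mono (by have := G.deg_le_card v; omega)

theorem Scanning.find {w : V} (hcol : Agrees lab S) (h : G.graph.Adj v w) (hw : lab w = q.goal b)
    (hmiss : ∀ (x : V) (hx : G.graph.Adj v x), G.portNum hx < G.portNum h → lab x ≠ q.goal b)
    (hq : q.returns = false) (hghost : G.GhostStep r w S att S' att')
    (H : G.Scanning r q.found b w (Function.update lab w (q.found.entry b)) S' att' N) :
    G.Scanning r q b v lab S att (N + (2 * Fintype.card V + 2)) := by
  have hlt := G.portNum_lt h
  have hle := G.deg_le_card v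
  refine (scanning_of_visit (N := N + 1) hcol h hmiss ?_).mono (by omega)
  obtain ⟨x, hx, h0⟩ := G.exists_port (v := w) (p := 0)
    (by have := G.portNum_lt h.symm; omega)
  refine LexCompletes.step hx (by simpa using G.portNum_lt h.symm) ?_ hcol hghost (H x hx h0)
  simp only [rule, if_pos hw, hq, h0]
  exact .zero _ _

theorem Scanning.findReturn {w : V} (hcol : Agrees lab S) (h : G.graph.Adj v w)
    (hw : lab w = q.goal b)
    (hmiss : ∀ (x : V) (hx : G.graph.Adj v x), G.portNum hx < G.portNum h → lab x ≠ q.goal b)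
    (hq : q.returns = true) (hq' : q.found ≠ .done) (hghost : G.GhostStep r v S att S' att')
    (H : G.Scanning r q.found b v (Function.update (Function.update lab w (.grey b .inner)) v
      (q.found.entry b)) S' att' N) :
    G.Scanning r q b v lab S att (N + (2 * Fintype.card V + 2)) := by
  have hlt := G.portNum_lt h
  have hle := G.deg_le_card v
  refine (scanning_of_visit (N := N + 1 + 1) hcol h hmiss ?_).mono (by omega)
  refine LexCompletes.step h.symm (by simpa using G.portNum_lt h.symm)
    (mode' := ⟨.start, q.found, b⟩) (l := .grey b .inner) ?_ hcol .refl ?_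
  · simp only [rule, if_pos hw, hq, if_true]
    exact .back _ _
  · refine start_scan (by simpa using G.portNum_lt h) (by omega) hq' ?_ hghost H
    intro x
    by_cases hx : x = w
    · subst hx
      rw [Function.update_self, ← hcol x, hw, Scan.colour_of_returns hq]
      rfl
    · rw [Function.update_of_ne hx, hcol x]

end

end PortGraph

/-! ## The invariant of the scans -/

open LexAgent

namespace PortGraph

variable {V : Type u} (G : PortGraph V)

/-- An induced path, listed from the tail. -/
def IsInducedPath : List V → Prop
  | [] => True
  | v :: P => v ∉ P ∧ (∀ w ∈ P, G.graph.Adj v w ↔ P.head? = some w) ∧ IsInducedPath P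

theorem IsInducedPath.nodup {G : PortGraph V} {P : List V} (h : G.IsInducedPath P) : P.Nodup := by
  induction P with
  | nil => exact List.nodup_nil
  | cons v P ih => exact List.nodup_cons.2 ⟨h.1, ih h.2.2⟩

/-- The number of white nodes. -/
noncomputable def whites (S : DFSState V) : ℕ := {v | S.colour v = Colour.white}.ncard

/-- `x :: P` is an induced path from `x` to the root, with nodes in the list `A`. -/
structure IsTrace (r : V) (A : List V) (x : V) (P : List V) : Prop where
  induced : G.IsInducedPath (x :: P)
  last : (x :: P).getLast? = some r
  mem : x ∈ A
  subset : ∀ y ∈ P, y ∈ A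

/-- Bounds the number of remaining scans, up to a contribution of the current scan. -/
noncomputable def potential [Fintype V] (S : DFSState V) : ℕ :=
  (11 * Fintype.card V + 5) * (whites S + S.stack.length)

/-- A state of Lex-DFS; the number of its white and grey nodes is at most the number of nodes. -/
structure IsSearchState [Fintype V] (r : V) (S : DFSState V) : Prop where
  regular : G.IsRegular r S
  card : whites S + S.stack.length ≤ Fintype.card V

section

variable {G} {r : V}

theorem IsTrace.not_mem {A : List V} {x : V} {P : List V} (h : G.IsTrace r A x P) : x ∉ P :=
  h.induced.1

theorem IsTrace.tail {A : List V} {x y : V} {P : List V} (h : G.IsTrace r A x (y :: P)) :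
    G.IsTrace r A y P where
  induced := h.induced.2.2
  last := by simpa [List.getLast?_cons_cons] using h.last
  mem := h.subset y (by simp)
  subset z hz := h.subset z (by simp [hz])

theorem IsTrace.adj_iff {A : List V} {x y : V} {P : List V} (h : G.IsTrace r A x P) (hy : y ∈ P) :
    G.graph.Adj x y ↔ P.head? = some y := h.induced.2.1 y hy

theorem IsTrace.length_le [Fintype V] {A : List V} {x : V} {P : List V} (h : G.IsTrace r A x P) :
    P.length + 1 ≤ Fintype.card V := h.induced.nodup.length_le_card

theorem IsSearchState.nodup [Fintype V] {S : DFSState V} {F A : List V} (h : G.IsSearchState r S)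
    (hs : S.stack = F ++ A) : F.Nodup ∧ A.Nodup ∧ ∀ a ∈ F, a ∉ A := by
  have := h.regular.nodup
  rw [hs, List.nodup_append] at this
  exact ⟨this.1, this.2.1, fun a ha hb => this.2.2 a ha a hb rfl⟩

theorem IsSearchState.grey [Fintype V] {S : DFSState V} (h : G.IsSearchState r S) {v : V}
    (hv : v ∈ S.stack) : S.colour v = .grey := (h.regular.grey v).2 hv

end

variable [DecidableEq V]

/-- The labels when the nodes of `F` carry the old bit and the other grey nodes the bit `b`; `P` consists of
the nodes marked `inner`, and `x`, `t` are the nodes marked `tail` and `target`. -/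
def labels (col : V → Colour) (b : Bool) (F P : List V) (x t : Option V) (v : V) : Label :=
  match col v with
  | .white => .white
  | .black => .black
  | .grey =>
    if v ∈ F then .grey (!b) .none
    else .grey b (if t = some v then .target else if x = some v then .tail
      else if v ∈ P then .inner else .none)

theorem agrees_labels (S : DFSState V) (b : Bool) (F P : List V) (x t : Option V) :
    Agrees (labels S.colour b F P x t) S := by
  intro v
  unfold labels
  cases S.colour v
  · rfl
  · dsimp only
    split <;> rfl
  · rfl

/-! ### Which nodes carry the label that a scan looks for -/

section labels

variable {col : V → Colour} {b : Bool} {F P : List V} {x t : Option V} {v : V}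

theorem labels_eq_white : labels col b F P x t v = .white ↔ col v = .white := by
  unfold labels
  cases col v <;> simp
  split <;> simp

theorem labels_eq_old : labels col b F P x t v = .grey (!b) .none ↔ col v = .grey ∧ v ∈ F := by
  unfold labels
  cases col v <;> simp

theorem labels_eq_inner : labels col b F P x t v = .grey b .inner ↔
    col v = .grey ∧ v ∉ F ∧ t ≠ some v ∧ x ≠ some v ∧ v ∈ P := by
  unfold labels
  cases col v <;> simp
  by_cases h : v ∈ F <;> by_cases ht : t = some v <;> by_cases hx : x = some v <;>
    by_cases hP : v ∈ P <;> simp [h, ht, hx, hP]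

theorem labels_eq_tail : labels col b F P x t v = .grey b .tail ↔
    col v = .grey ∧ v ∉ F ∧ t ≠ some v ∧ x = some v := by
  unfold labels
  cases col v <;> simp
  by_cases h : v ∈ F <;> by_cases ht : t = some v <;> by_cases hx : x = some v <;>
    by_cases hP : v ∈ P <;> simp [h, ht, hx, hP]

theorem labels_eq_target : labels col b F P x t v = .grey b .target ↔
    col v = .grey ∧ v ∉ F ∧ t = some v := by
  unfold labels
  cases col v <;> simp
  by_cases h : v ∈ F <;> by_cases ht : t = some v <;> by_cases hx : x = some v <;>
    by_cases hP : v ∈ P <;> simp [h, ht, hx, hP]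

theorem update_labels {lab : V → Label} {lab' : V → Label} {w : V} {l : Label}
    (hw : lab' w = l) (h : ∀ v, v ≠ w → lab v = lab' v) : Function.update lab w l = lab' := by
  funext v
  by_cases hv : v = w
  · subst hv; rw [Function.update_self, hw]
  · rw [Function.update_of_ne hv, h v hv]

end labels

variable [Fintype V]

/-- The scan `q` at `v` is in progress; the last number bounds the number of remaining scans. -/
inductive Invariant (r : V) : Scan → Bool → V → (V → Label) → DFSState V → Prop → ℕ → Prop
  | advance {b v S F A P} (hS : G.IsSearchState r S) (hstack : S.stack = F ++ v :: A)
      (ht : G.IsTrace r (v :: A) v P) :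
      Invariant r .advance b v (labels S.colour b F P (some v) none) S (F = [])
        (potential S + 10 * (F.length + whites S) + 4 * P.length + 2)
  | discover {b v S A P} (hS : G.IsSearchState r S) (hstack : S.stack = v :: A)
      (ht : G.IsTrace r (v :: A) v P)  :
      Invariant r .discover b v (labels S.colour b [] P (some v) none) S True
        (potential S + 10 * whites S + 4 * P.length + 1)
  | finish {b v S P} (hS : G.IsSearchState r S) (hv : S.colour v = .black)
      (ht : G.IsTrace r (v :: S.stack) v P) (hroot : v = r → S.stack = []) :
      Invariant r .finish b v (labels S.colour b [] P none none) S False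
        (potential S + 10 * Fintype.card V + 4 + P.length)
  | retreat {b v S P} (hS : G.IsSearchState r S) (ht : G.IsTrace r S.stack v P) :
      Invariant r .retreat b v (labels S.colour b [] P none none) S False
        (potential S + 10 * Fintype.card V + 3 + P.length)
  | probe {b t S F A x P} (hS : G.IsSearchState r S) (hstack : S.stack = F ++ t :: A)
      (ht : G.IsTrace r A x P) (hadj : G.graph.Adj t x) :
      Invariant r .probe b t (labels S.colour b F P (some x) (some t)) S (F = [])
        (potential S + 10 * (F.length + whites S) + 4 * P.length + 8)
  | toTail {b t S F A x P} (hS : G.IsSearchState r S) (hstack : S.stack = F ++ t :: A)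
      (ht : G.IsTrace r A x P) (hadj : G.graph.Adj t x) (hP : ∃ y ∈ P, G.graph.Adj t y) :
      Invariant r .toTail b t (labels S.colour b F P (some x) (some t)) S (F = [])
        (potential S + 10 * (F.length + whites S) + 4 * P.length + 7)
  | attach {b t S F A x P} (hS : G.IsSearchState r S) (hstack : S.stack = F ++ t :: A)
      (ht : G.IsTrace r A x P) (hadj : G.graph.Adj t x) (hP : ∀ y ∈ P, ¬ G.graph.Adj t y) :
      Invariant r .attach b t (labels S.colour b F P (some x) (some t)) S (F = [])
        (potential S + 10 * (F.length + whites S) + 4 * P.length + 7)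
  | cut {b t S F A x P} (hS : G.IsSearchState r S) (hstack : S.stack = F ++ t :: A)
      (ht : G.IsTrace r A x P) (hP : ∃ y ∈ P, G.graph.Adj t y) :
      Invariant r .cut b x (labels S.colour b F P none (some t)) S (F = [])
        (potential S + 10 * (F.length + whites S) + 4 * P.length + 6)
  | touch {b t S F A x P} (hS : G.IsSearchState r S) (hstack : S.stack = F ++ t :: A)
      (ht : G.IsTrace r A x P) (hP : ∃ y ∈ x :: P, G.graph.Adj t y) :
      Invariant r .touch b x (labels S.colour b F P (some x) (some t)) S (F = [])
        (potential S + 10 * (F.length + whites S) + 4 * P.length + 9)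

variable (r : V) in
/-- All scans with a bound less than `N` are completed in time. -/
def CompletesBelow (N : ℕ) : Prop :=
  ∀ (q : Scan) (b : Bool) (v : V) (lab : V → Label) (S : DFSState V) (att : Prop) (n : ℕ), n < N →
    G.Invariant r q b v lab S att n →
      G.Scanning r q b v lab S att (N * (2 * Fintype.card V + 2))

end PortGraph

/-! ## The progress of the scans -/

namespace PortGraph

variable {V : Type u} {G : PortGraph V} {r : V} [DecidableEq V] [Fintype V]

theorem whites_update_grey {col : V → Colour} {w : V} (hw : col w = .white) (s s' : List V) :
    whites ⟨s, Function.update col w .grey⟩ + 1 = whites ⟨s', col⟩ := by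
  have : {v | Function.update col w .grey v = Colour.white} = {v | col v = .white} \ {w} := by
    ext v
    by_cases hv : v = w
    · subst hv; simp
    · simp [hv]
  simp only [whites, this]
  exact Set.ncard_sdiff_singleton_add_one hw (Set.toFinite _)

omit [Fintype V] in
theorem whites_update_black {col : V → Colour} {w : V} (hw : col w = .grey) (s s' : List V) :
    whites ⟨s, Function.update col w .black⟩ = whites ⟨s', col⟩ := by
  have : {v | Function.update col w .black v = Colour.white} = {v | col v = .white} := by
    ext v
    by_cases hv : v = w
    · subst hv; simp [hw]
    · simp [Function.update_of_ne hv]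
  simp only [whites, this]

/-! ### Scans that advance, discover, finish and retreat -/

section

variable {col : V → Colour} {b : Bool} {F P : List V} {x t : Option V} {v w : V}

/-- The old nodes are those after `v` on the grey path. By `IsRegular.least`, the first old
neighbour is the direct successor `f`; if there are no old nodes, `v` is the search head. Shortening
`F` by `f` releases 10, which covers the rise from 2 to 8. -/
theorem Invariant.scanning_advance {S : DFSState V} {A : List V} (hdeg : ∀ v, 0 < G.deg v)
    (hS : G.IsSearchState r S) (hstack : S.stack = F ++ v :: A) (ht : G.IsTrace r (v :: A) v P)
    {N : ℕ} (hN : N = potential S + 10 * (F.length + whites S) + 4 * P.length + 2)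
    (hrec : G.CompletesBelow r N) :
    G.Scanning r .advance b v (labels S.colour b F P (some v) none) S (F = [])
      (N * (2 * Fintype.card V + 2) + (2 * Fintype.card V + 2)) := by
  have hnd := hS.nodup hstack
  rcases F.eq_nil_or_concat' with rfl | ⟨F, f, rfl⟩
  · refine Scanning.miss (att' := True) (hdeg v) (agrees_labels _ _ _ _ _ _) (fun y _ hy => ?_)
      (by decide) (.inl ⟨rfl, fun _ => .inl rfl⟩) ?_
    · simpa using (labels_eq_old.1 hy).2
    · simp only [Scan.missed, Scan.missedBit, Scan.entry]
      rw [update_labels (labels_eq_tail.2 ⟨hS.grey (by simp [hstack]), by simp, by simp, rfl⟩)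
        (fun _ _ => rfl)]
      exact hrec _ _ _ _ _ _ _ (by simp at hN; omega) (.discover hS hstack ht)
  · obtain ⟨hadj, hleast⟩ := hS.regular.least F f v A (by simpa using hstack)
    have hfF : f ∉ F := fun h => by
      have := (List.nodup_append.1 hnd.1).2.2 f h f (by simp)
      exact this rfl
    have hf : S.colour f = .grey := hS.grey (by simp [hstack])
    refine Scanning.find (w := f) (att' := F = []) (agrees_labels _ _ _ _ _ _) hadj
      (labels_eq_old.2 ⟨hf, by simp⟩) (fun y hy hlt hgoal => ?_) rfl
      (.inl ⟨rfl, fun h => .inr (by simp [hstack, h])⟩) ?_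
    · have := (labels_eq_old.1 hgoal).2
      rcases List.mem_append.1 this with h | h
      · exact absurd (hleast y hy (.inl h)) (by omega)
      · obtain rfl : y = f := by simpa using h
        exact lt_irrefl _ hlt
    · simp only [Scan.found, Scan.entry]
      rw [update_labels (lab' := labels S.colour b F P (some v) (some f))
        (labels_eq_target.2 ⟨hf, hfF, rfl⟩) (fun u hu => by simp [labels, hu, Ne.symm hu])]
      exact hrec _ _ _ _ _ _ _ (by simp at hN; omega)
        (.probe hS (by simpa using hstack) ht hadj.symm)

theorem Invariant.scanning_discover {S : DFSState V} {A : List V} (hdeg : ∀ v, 0 < G.deg v)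
    (hS : G.IsSearchState r S) (hstack : S.stack = v :: A) (ht : G.IsTrace r (v :: A) v P)
    {N : ℕ} (hN : N = potential S + 10 * whites S + 4 * P.length + 1)
    (hrec : G.CompletesBelow r N) :
    G.Scanning r .discover b v (labels S.colour b [] P (some v) none) S True
      (N * (2 * Fintype.card V + 2) + (2 * Fintype.card V + 2)) := by
  obtain ⟨stack, col⟩ := S
  obtain rfl : stack = v :: A := hstack
  have hv : col v = .grey := hS.grey (by simp)
  have hcard := hS.card
  by_cases hex : ∃ w, G.graph.Adj v w ∧ col w = .white
  · obtain ⟨w, hadj, hw, hmin⟩ := G.exists_least_port hex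
    have hmove : G.LexMove r ⟨v :: A, col⟩ ⟨w :: v :: A, Function.update col w .grey⟩ :=
      .forward v w A col hadj hw hmin
    have hwh := whites_update_grey hw (w :: v :: A) (v :: A)
    -- The node `w` only changes from white to grey. The next scan is paid for by the 10 of the
    -- white node lost.
    have hpot : potential ⟨w :: v :: A, Function.update col w .grey⟩ = potential ⟨v :: A, col⟩ := by
      simp only [potential, ← hwh, List.length_cons]
      ring
    have hS' : G.IsSearchState r ⟨w :: v :: A, Function.update col w .grey⟩ :=
      ⟨hmove.isRegular hS.regular, by simp only [List.length_cons] at hcard ⊢; omega⟩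
    refine Scanning.find (w := w) (att' := ([] : List V) = []) (agrees_labels ⟨_, col⟩ _ _ _ _ _) hadj
      (labels_eq_white.2 hw) (fun y hy hlt hgoal => ?_) rfl
      (.inr ⟨hmove, fun _ => by simp, fun _ _ => .inl trivial⟩) ?_
    · exact absurd (hmin y hy (labels_eq_white.1 hgoal)) (by omega)
    · change G.Scanning r .probe b w (Function.update _ w (.grey b .target)) _ _ _
      rw [update_labels (lab' := labels (Function.update col w .grey) b [] P (some v) (some w))
        (labels_eq_target.2 ⟨by simp, by simp, rfl⟩)
        (fun u hu => by simp [labels, hu, Ne.symm hu])]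
      exact hrec _ _ _ _ _ _ _ (by simp only [List.length_nil]; omega)
        (.probe (F := []) hS' rfl ht hadj.symm)
  · have hnone : ∀ y, G.graph.Adj v y → col y ≠ .white := fun y hy hw => hex ⟨y, hy, hw⟩
    have hmove : G.LexMove r ⟨v :: A, col⟩ ⟨A, Function.update col v .black⟩ :=
      .back v A col hnone
    have hwh := whites_update_black hv A (v :: A)
    -- The amount released covers the return to the root and a fresh charge of 10 for each node that
    -- the next round may append.
    have hpot : potential ⟨A, Function.update col v .black⟩ + (11 * Fintype.card V + 5) =
        potential ⟨v :: A, col⟩ := by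
      simp only [potential, hwh, List.length_cons]
      ring
    have hS' : G.IsSearchState r ⟨A, Function.update col v .black⟩ :=
      ⟨hmove.isRegular hS.regular, by simp only [List.length_cons] at hcard ⊢; omega⟩
    have hroot : v = r → A = [] := by
      rintro rfl
      by_contra hA
      have h1 : v ∉ A := (List.nodup_cons.1 hS.regular.nodup).1
      refine h1 ?_
      have h2 := hS.regular.root (A.getLast hA) (by
        simp [List.getLast?_cons, List.getLast?_eq_some_getLast hA])
      rw [← h2]
      exact List.getLast_mem hA
    have hlen := ht.length_le
    refine Scanning.miss (att' := False) (hdeg v) (agrees_labels ⟨_, col⟩ _ _ _ _ _)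
      (fun y hy h => hnone y hy (labels_eq_white.1 h)) (by decide)
      (.inr ⟨hmove, False.elim, fun _ _ => .inl trivial⟩) ?_
    simp only [Scan.missed, Scan.missedBit, Scan.entry]
    rw [update_labels (lab' := labels (Function.update col v .black) b [] P none none)
      (by simp [labels]) (fun u hu => by simp [labels, hu, Ne.symm hu])]
    exact hrec _ _ _ _ _ _ _ (by omega) (.finish hS' (by simp) ht hroot)

/-- If `v` has a predecessor on the induced path, it is the only `inner` neighbour of `v`. Otherwise
`v` is the root, the search is over, and the agent halts. -/
theorem Invariant.scanning_finish {S : DFSState V} (hdeg : ∀ v, 0 < G.deg v)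
    (hS : G.IsSearchState r S) (hv : S.colour v = .black) (ht : G.IsTrace r (v :: S.stack) v P)
    (hroot : v = r → S.stack = [])
    {N : ℕ} (hN : N = potential S + 10 * Fintype.card V + 4 + P.length)
    (hrec : G.CompletesBelow r N) :
    G.Scanning r .finish b v (labels S.colour b [] P none none) S False
      (N * (2 * Fintype.card V + 2) + (2 * Fintype.card V + 2)) := by
  cases P with
  | nil =>
    have hstack := hroot (by simpa using ht.last)
    refine (Scanning.halt (hdeg v) (agrees_labels _ _ _ _ _ _) (fun y _ hy => ?_) rfl hstack
      fun S' h => ?_).mono (Nat.le_add_left _ _)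
    · simpa using (labels_eq_inner.1 hy).2.2.2.2
    · cases h with
      | start => simp [DFSState.initial] at hv
      | forward => simp at hstack
      | back => simp at hstack
  | cons w P =>
    have hadj : G.graph.Adj v w := (ht.adj_iff (by simp)).2 rfl
    have hmem : ∀ y ∈ w :: P, y ∈ S.stack := fun y hy =>
      (List.mem_cons.1 (ht.subset y hy)).resolve_left (fun h => ht.not_mem (h ▸ hy))
    have hw := hS.grey (hmem w (by simp))
    refine Scanning.find (w := w) (att' := False) (agrees_labels _ _ _ _ _ _) hadj
      (labels_eq_inner.2 ⟨hw, by simp, by simp, by simp, by simp⟩) (fun y hy hlt hgoal => ?_) rfl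
      .refl ?_
    · have := (ht.adj_iff (labels_eq_inner.1 hgoal).2.2.2.2).1 hy
      obtain rfl : w = y := by simpa using this
      exact lt_irrefl _ hlt
    · simp only [Scan.found, Scan.entry]
      rw [update_labels (lab' := labels S.colour b [] P none none)
        (by simp [labels, hw, ht.tail.not_mem]) (fun u hu => by simp [labels, hu])]
      exact hrec _ _ _ _ _ _ _ (by simp at hN; omega)
        (.retreat hS ⟨ht.tail.induced, ht.tail.last, hmem w (by simp),
          fun y hy => hmem y (by simp [hy])⟩)

/-- Each node erases its own mark on arrival, so the remaining path is again an induced one and its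
next node the only `inner` neighbour. Only the root finds none, and there a new round begins. -/
theorem Invariant.scanning_retreat {S : DFSState V} (hdeg : ∀ v, 0 < G.deg v)
    (hS : G.IsSearchState r S) (ht : G.IsTrace r S.stack v P)
    {N : ℕ} (hN : N = potential S + 10 * Fintype.card V + 3 + P.length)
    (hrec : G.CompletesBelow r N) :
    G.Scanning r .retreat b v (labels S.colour b [] P none none) S False
      (N * (2 * Fintype.card V + 2) + (2 * Fintype.card V + 2)) := by
  cases P with
  | nil =>
    obtain rfl : v = r := by simpa using ht.last
    have hne : S.stack ≠ [] := List.ne_nil_of_mem ht.mem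
    obtain ⟨F, hstack⟩ : ∃ F, S.stack = F ++ [v] := by
      refine ⟨S.stack.dropLast, ?_⟩
      have := hS.regular.root (S.stack.getLast hne) (by
        simp [List.getLast?_eq_some_getLast hne])
      conv_lhs => rw [← List.dropLast_append_getLast hne, this]
    have hnd := hS.nodup hstack
    have hcard := hS.card
    have hvF : v ∉ F := fun h => hnd.2.2 v h (by simp)
    refine Scanning.miss (att' := F = []) (hdeg v) (agrees_labels _ _ _ _ _ _) (fun y _ hy => ?_)
      (by decide) (.inl ⟨rfl, fun h => .inr (by simp [hstack, h])⟩) ?_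
    · simpa using (labels_eq_inner.1 hy).2.2.2.2
    · simp only [Scan.missed, Scan.missedBit, Scan.entry]
      -- Flipping the bit in the memory makes all grey nodes old at once, without visiting them;
      -- only the root is relabelled.
      rw [update_labels (lab' := labels S.colour (!b) F [] (some v) none)
        (by simp [labels, hS.grey ht.mem, hvF]) (fun u hu => by
          have hgrey := hS.regular.grey u
          simp only [hstack, List.mem_append, List.mem_singleton, hu, or_false] at hgrey
          unfold labels
          cases hu : S.colour u
          · rfl
          · simp [hgrey.1 hu]
          · rfl)]
      refine hrec _ _ _ _ _ _ _ ?_ (.advance (A := []) hS hstack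
        ⟨ht.induced, ht.last, by simp, by simp⟩)
      -- Grey and white nodes number at most `n`, root included, so the reserve `10 * n` covers `10
      -- * (F.length + whites S)`.
      simp only [hstack, List.length_append, List.length_singleton] at hcard
      simp only [List.length_nil] at hN ⊢
      omega
  | cons w P =>
    have hadj : G.graph.Adj v w := (ht.adj_iff (by simp)).2 rfl
    have hw := hS.grey (ht.subset w (by simp))
    refine Scanning.find (w := w) (att' := False) (agrees_labels _ _ _ _ _ _) hadj
      (labels_eq_inner.2 ⟨hw, by simp, by simp, by simp, by simp⟩) (fun y hy hlt hgoal => ?_) rfl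
      .refl ?_
    · have := (ht.adj_iff (labels_eq_inner.1 hgoal).2.2.2.2).1 hy
      obtain rfl : w = y := by simpa using this
      exact lt_irrefl _ hlt
    · simp only [Scan.found, Scan.entry]
      rw [update_labels (lab' := labels S.colour b [] P none none)
        (by simp [labels, hw, ht.tail.not_mem]) (fun u hu => by simp [labels, hu])]
      exact hrec _ _ _ _ _ _ _ (by simp at hN; omega) (.retreat hS ht.tail)

end

/-! ### Scans that append a target to the induced path -/

section

variable {b : Bool} {F A P : List V} {x t : V} {S : DFSState V}

omit [DecidableEq V] in
/-- The target and the trace are disjoint from each other and from the remainder of the grey path. -/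
theorem IsTrace.separate (ht : G.IsTrace r A x P) (hS : G.IsSearchState r S)
    (hstack : S.stack = F ++ t :: A) :
    (S.colour t = .grey ∧ t ∉ F ∧ t ≠ x ∧ t ∉ P) ∧
      ∀ y ∈ x :: P, S.colour y = .grey ∧ y ∉ F ∧ t ≠ y := by
  have hnd := hS.nodup hstack
  have htA : t ∉ A := (List.nodup_cons.1 hnd.2.1).1
  have hA : ∀ y ∈ x :: P, y ∈ A := by
    intro y hy
    rcases List.mem_cons.1 hy with rfl | hy
    · exact ht.mem
    · exact ht.subset y hy
  refine ⟨⟨hS.grey (by simp [hstack]), fun h => hnd.2.2 t h (by simp), ?_, ?_⟩, fun y hy => ⟨?_, ?_, ?_⟩⟩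
  · rintro rfl
    exact htA ht.mem
  · exact fun h => htA (ht.subset t h)
  · exact hS.grey (by simp [hstack, hA y hy])
  · exact fun h => hnd.2.2 y h (by simp [hA y hy])
  · rintro rfl
    exact htA (hA _ hy)

/-- The target already touches the tail `x`, so the path extended by `t` is induced exactly when `t`
has no neighbour in `P`, that is, no `inner` neighbour. No label changes: the neighbour found was
`inner` already. -/
theorem Invariant.scanning_probe (hdeg : ∀ v, 0 < G.deg v)
    (hS : G.IsSearchState r S) (hstack : S.stack = F ++ t :: A)
    (ht : G.IsTrace r A x P) (hadj : G.graph.Adj t x)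
    {N : ℕ} (hN : N = potential S + 10 * (F.length + whites S) + 4 * P.length + 8)
    (hrec : G.CompletesBelow r N) :
    G.Scanning r .probe b t (labels S.colour b F P (some x) (some t)) S (F = [])
      (N * (2 * Fintype.card V + 2) + (2 * Fintype.card V + 2)) := by
  obtain ⟨⟨htg, htF, htx, htP⟩, htrace⟩ := ht.separate hS hstack
  have hin : ∀ y, labels S.colour b F P (some x) (some t) y = .grey b .inner ↔ y ∈ P := by
    intro y
    rw [labels_eq_inner]
    refine ⟨fun h => h.2.2.2.2, fun h => ?_⟩
    obtain ⟨h1, h2, h3⟩ := htrace y (by simp [h])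
    refine ⟨h1, h2, by simpa using h3, ?_, h⟩
    rintro ⟨⟩
    exact ht.not_mem h
  have hself : labels S.colour b F P (some x) (some t) t = .grey b .target :=
    labels_eq_target.2 ⟨htg, htF, rfl⟩
  by_cases hex : ∃ y, G.graph.Adj t y ∧ y ∈ P
  · obtain ⟨y, hty, hyP, hmin⟩ := G.exists_least_port hex
    refine Scanning.findReturn (w := y) (att' := F = []) (agrees_labels _ _ _ _ _ _) hty
      ((hin y).2 hyP) (fun z hz hlt hgoal => ?_) rfl (by decide) .refl ?_
    · exact absurd (hmin z hz ((hin z).1 hgoal)) (by omega)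
    · simp only [Scan.found, Scan.entry]
      rw [update_labels ((hin y).2 hyP) (fun _ _ => rfl), update_labels hself (fun _ _ => rfl)]
      exact hrec _ _ _ _ _ _ _ (by omega) (.toTail hS hstack ht hadj ⟨y, hyP, hty⟩)
  · refine Scanning.miss (att' := F = []) (hdeg t) (agrees_labels _ _ _ _ _ _)
      (fun y hy h => hex ⟨y, hy, (hin y).1 h⟩) (by decide) .refl ?_
    simp only [Scan.missed, Scan.missedBit, Scan.entry]
    rw [update_labels hself (fun _ _ => rfl)]
    exact hrec _ _ _ _ _ _ _ (by omega)
      (.attach hS hstack ht hadj fun y hy h => hex ⟨y, h, hy⟩)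

theorem update_labels_cut (hS : G.IsSearchState r S) (hstack : S.stack = F ++ t :: A)
    (ht : G.IsTrace r A x P) :
    Function.update (labels S.colour b F P (some x) (some t)) x (.grey b .none) =
      labels S.colour b F P none (some t) := by
  obtain ⟨h1, h2, h3⟩ := (ht.separate hS hstack).2 x (by simp)
  exact update_labels (by simp [labels, h1, h2, h3, ht.not_mem])
    (fun u hu => by simp [labels, Ne.symm hu])

theorem Invariant.scanning_toTail
    (hS : G.IsSearchState r S) (hstack : S.stack = F ++ t :: A)
    (ht : G.IsTrace r A x P) (hadj : G.graph.Adj t x) (hP : ∃ y ∈ P, G.graph.Adj t y)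
    {N : ℕ} (hN : N = potential S + 10 * (F.length + whites S) + 4 * P.length + 7)
    (hrec : G.CompletesBelow r N) :
    G.Scanning r .toTail b t (labels S.colour b F P (some x) (some t)) S (F = [])
      (N * (2 * Fintype.card V + 2) + (2 * Fintype.card V + 2)) := by
  obtain ⟨h1, h2, h3⟩ := (ht.separate hS hstack).2 x (by simp)
  refine Scanning.find (w := x) (att' := F = []) (agrees_labels _ _ _ _ _ _) hadj
    (labels_eq_tail.2 ⟨h1, h2, by simpa using h3, rfl⟩) (fun z hz hlt hgoal => ?_) rfl .refl ?_
  · obtain rfl : x = z := by simpa using (labels_eq_tail.1 hgoal).2.2.2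
    exact lt_irrefl _ hlt
  · simp only [Scan.found, Scan.entry]
    rw [update_labels_cut hS hstack ht]
    exact hrec _ _ _ _ _ _ _ (by omega) (.cut hS hstack ht hP)

/-- The failed probe makes `t :: x :: P` an induced path. The old tail becomes `inner`, and the 4
set aside for it on the longer path will pay for cutting it later. -/
theorem Invariant.scanning_attach
    (hS : G.IsSearchState r S) (hstack : S.stack = F ++ t :: A)
    (ht : G.IsTrace r A x P) (hadj : G.graph.Adj t x) (hP : ∀ y ∈ P, ¬ G.graph.Adj t y)
    {N : ℕ} (hN : N = potential S + 10 * (F.length + whites S) + 4 * P.length + 7)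
    (hrec : G.CompletesBelow r N) :
    G.Scanning r .attach b t (labels S.colour b F P (some x) (some t)) S (F = [])
      (N * (2 * Fintype.card V + 2) + (2 * Fintype.card V + 2)) := by
  obtain ⟨⟨htg, htF, htx, htP⟩, htrace⟩ := ht.separate hS hstack
  obtain ⟨h1, h2, h3⟩ := htrace x (by simp)
  have ht' : G.IsTrace r (t :: A) t (x :: P) := by
    refine ⟨⟨by simp [htx, htP], fun y hy => ?_, ht.induced⟩, ?_, by simp, fun y hy => ?_⟩
    · rcases List.mem_cons.1 hy with rfl | hy
      · simp [hadj]
      · simp only [hP y hy, List.head?_cons, Option.some.injEq, false_iff]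
        rintro rfl
        exact ht.not_mem hy
    · simpa [List.getLast?_cons_cons] using ht.last
    · rcases List.mem_cons.1 hy with rfl | hy
      · simp [ht.mem]
      · simp [ht.subset y hy]
  refine Scanning.findReturn (w := x) (att' := F = []) (agrees_labels _ _ _ _ _ _) hadj
    (labels_eq_tail.2 ⟨h1, h2, by simpa using h3, rfl⟩) (fun z hz hlt hgoal => ?_) rfl
    (by decide) .refl ?_
  · obtain rfl : x = z := by simpa using (labels_eq_tail.1 hgoal).2.2.2
    exact lt_irrefl _ hlt
  · simp only [Scan.found, Scan.entry]
    rw [update_labels (w := t) (lab' := labels S.colour b F (x :: P) (some t) none)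
      (by simp [labels, htg, htF]) (fun u hu => by
        by_cases hux : u = x
        · subst hux
          simp [labels, h1, h2, h3]
        · simp [labels, hux, Ne.symm hux, Ne.symm hu])]
    exact hrec _ _ _ _ _ _ _ (by simp; omega) (.advance hS hstack ht')

/-- The target has a neighbour in `P`, so `P` is not empty and the cut never passes the root. Losing
one path node releases 4, which covers the rise from 6 to 9. -/
theorem Invariant.scanning_cut
    (hS : G.IsSearchState r S) (hstack : S.stack = F ++ t :: A)
    (ht : G.IsTrace r A x P) (hP : ∃ y ∈ P, G.graph.Adj t y)
    {N : ℕ} (hN : N = potential S + 10 * (F.length + whites S) + 4 * P.length + 6)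
    (hrec : G.CompletesBelow r N) :
    G.Scanning r .cut b x (labels S.colour b F P none (some t)) S (F = [])
      (N * (2 * Fintype.card V + 2) + (2 * Fintype.card V + 2)) := by
  obtain ⟨w, P, rfl⟩ : ∃ w P', P = w :: P' := by
    obtain ⟨y, hy, -⟩ := hP
    exact List.exists_cons_of_ne_nil (List.ne_nil_of_mem hy)
  obtain ⟨h1, h2, h3⟩ := (ht.separate hS hstack).2 w (by simp)
  refine Scanning.find (w := w) (att' := F = []) (agrees_labels _ _ _ _ _ _)
    ((ht.adj_iff (by simp)).2 rfl)
    (labels_eq_inner.2 ⟨h1, h2, by simpa using h3, by simp, by simp⟩)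
    (fun y hy hlt hgoal => ?_) rfl .refl ?_
  · have := (ht.adj_iff (labels_eq_inner.1 hgoal).2.2.2.2).1 hy
    obtain rfl : w = y := by simpa using this
    exact lt_irrefl _ hlt
  · simp only [Scan.found, Scan.entry]
    rw [update_labels (lab' := labels S.colour b F P (some w) (some t))
      (labels_eq_tail.2 ⟨h1, h2, by simpa using h3, rfl⟩)
      (fun u hu => by simp [labels, hu, Ne.symm hu])]
    exact hrec _ _ _ _ _ _ _ (by simp at hN; omega) (.touch hS hstack ht.tail hP)

/-- If the new tail is adjacent to `t`, the agent returns to `t` and probes again, as nearer to the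
root there may be further neighbours. If not, the neighbour promised by `hP` lies in `P` and cutting
goes on. -/
theorem Invariant.scanning_touch (hdeg : ∀ v, 0 < G.deg v)
    (hS : G.IsSearchState r S) (hstack : S.stack = F ++ t :: A)
    (ht : G.IsTrace r A x P) (hP : ∃ y ∈ x :: P, G.graph.Adj t y)
    {N : ℕ} (hN : N = potential S + 10 * (F.length + whites S) + 4 * P.length + 9)
    (hrec : G.CompletesBelow r N) :
    G.Scanning r .touch b x (labels S.colour b F P (some x) (some t)) S (F = [])
      (N * (2 * Fintype.card V + 2) + (2 * Fintype.card V + 2)) := by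
  obtain ⟨⟨htg, htF, htx, htP⟩, htrace⟩ := ht.separate hS hstack
  have hself : labels S.colour b F P (some x) (some t) t = .grey b .target :=
    labels_eq_target.2 ⟨htg, htF, rfl⟩
  by_cases hadj : G.graph.Adj x t
  · refine Scanning.find (w := t) (att' := F = []) (agrees_labels _ _ _ _ _ _) hadj
      hself (fun z hz hlt hgoal => ?_) rfl .refl ?_
    · obtain rfl : t = z := by simpa using (labels_eq_target.1 hgoal).2.2
      exact lt_irrefl _ hlt
    · simp only [Scan.found, Scan.entry]
      rw [update_labels hself (fun _ _ => rfl)]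
      exact hrec _ _ _ _ _ _ _ (by omega) (.probe hS hstack ht hadj.symm)
  · refine Scanning.miss (att' := F = []) (hdeg x) (agrees_labels _ _ _ _ _ _)
      (fun z hz hgoal => ?_) (by decide) .refl ?_
    · obtain rfl : t = z := by simpa using (labels_eq_target.1 hgoal).2.2
      exact hadj hz
    · simp only [Scan.missed, Scan.missedBit, Scan.entry]
      rw [update_labels_cut hS hstack ht]
      refine hrec _ _ _ _ _ _ _ (by omega) (.cut hS hstack ht ?_)
      obtain ⟨y, hy, hty⟩ := hP
      rcases List.mem_cons.1 hy with rfl | hy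
      · exact absurd hty.symm hadj
      · exact ⟨y, hy, hty⟩

end

/-- Strong induction on the bound: each scan either halts or leads to a scan with a smaller bound,
at a cost of at most `2 * Fintype.card V + 2` agent steps. -/
theorem Invariant.scanning {q : Scan} {b : Bool} {v : V} {lab : V → Label} {S : DFSState V}
    {att : Prop} {N : ℕ} (hdeg : ∀ v, 0 < G.deg v) (h : G.Invariant r q b v lab S att N) :
    G.Scanning r q b v lab S att ((N + 1) * (2 * Fintype.card V + 2)) := by
  induction N using Nat.strong_induction_on generalizing q b v lab S att with
  | _ N ih =>
  have hrec : G.CompletesBelow r N := fun q b v lab S att n hn hI =>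
    (ih n hn hI).mono (Nat.mul_le_mul_right _ hn)
  rw [Nat.succ_mul]
  clear ih
  cases h with
  | advance hS hstack ht => exact scanning_advance hdeg hS hstack ht rfl hrec
  | discover hS hstack ht => exact scanning_discover hdeg hS hstack ht rfl hrec
  | finish hS hv ht hroot => exact scanning_finish hdeg hS hv ht hroot rfl hrec
  | retreat hS ht => exact scanning_retreat hdeg hS ht rfl hrec
  | probe hS hstack ht hadj => exact scanning_probe hdeg hS hstack ht hadj rfl hrec
  | toTail hS hstack ht hadj hP => exact scanning_toTail hS hstack ht hadj hP rfl hrec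
  | attach hS hstack ht hadj hP => exact scanning_attach hS hstack ht hadj hP rfl hrec
  | cut hS hstack ht hP => exact scanning_cut hS hstack ht hP rfl hrec
  | touch hS hstack ht hP => exact scanning_touch hdeg hS hstack ht hP rfl hrec

end PortGraph

/-! ## The complete execution -/

namespace PortGraph

variable {V : Type u} {G : PortGraph V} {r : V}

theorem eq_of_deg_eq_zero {v : V} (hv : G.deg v = 0) (w : V) : w = v := by
  obtain ⟨p⟩ := G.connected.preconnected v w
  cases p with
  | nil => rfl
  | cons h _ =>
    have := G.portNum_lt h
    omega

variable [Fintype V]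

theorem whites_le_card (S : DFSState V) : whites S ≤ Fintype.card V := by
  rw [← Nat.card_eq_fintype_card, ← Set.ncard_univ]
  exact Set.ncard_le_ncard (Set.subset_univ _) (Set.toFinite _)

variable [DecidableEq V]

/-- The initial configuration of the agent. -/
def startConf (r : V) : LabelConf V Mode Label :=
  ⟨r, none, ⟨.start, .advance, true⟩, fun _ => .white⟩

/-- The first agent step discovers the root and starts an `advance` scan there. The quadratic factor
is the bound of that scan plus one, with `whites + 1 ≤ n`; the final `+ 1` is the first step itself.
-/
theorem completes_startConf (hdeg : ∀ v, 0 < G.deg v) :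
    G.LexCompletes r (startConf r) (DFSState.initial V) False
      ((11 * Fintype.card V ^ 2 + 15 * Fintype.card V + 3) * (2 * Fintype.card V + 2) + 1) := by
  set col := Function.update (DFSState.initial V).colour r Colour.grey with hcol
  have hmove : G.LexMove r (DFSState.initial V) ⟨[r], col⟩ := .start
  have hwh : whites ⟨[r], col⟩ + 1 ≤ Fintype.card V :=
    (whites_update_grey (col := (DFSState.initial V).colour) rfl [r] []).trans_le (whites_le_card _)
  have hS : G.IsSearchState r ⟨[r], col⟩ := ⟨hmove.isRegular isRegular_initial, hwh⟩
  have hI := Invariant.scanning hdeg (Invariant.advance (b := true) (F := []) (A := []) (P := [])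
    hS rfl ⟨⟨by simp, by simp, trivial⟩, rfl, by simp, by simp⟩)
  refine (start_scan (q := .advance) (by simp) (hdeg r) (by decide) (fun _ => rfl)
    (.inr ⟨hmove, fun _ => by simp, fun u hu => by simp [DFSState.initial] at hu⟩)
    (?_ : G.Scanning r .advance true r _ _ (([] : List V) = []) _)).mono le_rfl
  change G.Scanning r .advance true r (Function.update (fun _ => Label.white) r (.grey true .tail))
    _ _ _
  rw [update_labels (lab' := labels col true [] [] (some r) none)
    (by simp [labels, hcol]) (fun u hu => by simp [labels, hcol, hu, DFSState.initial])]
  refine hI.mono (Nat.mul_le_mul_right _ ?_)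
  simp only [potential, List.length_nil, List.length_singleton]
  have h1 : (11 * Fintype.card V + 5) * (whites ⟨[r], col⟩ + 1) ≤
      (11 * Fintype.card V + 5) * Fintype.card V := Nat.mul_le_mul_left _ hwh
  have h2 : (11 * Fintype.card V + 5) * Fintype.card V =
      11 * Fintype.card V ^ 2 + 5 * Fintype.card V := by ring
  omega

/-! ### Executions of the concrete machine -/

section Encoding

variable {m : ℕ} (hm : 0 < m) {eA : Mode → Fin m → Bool} {eB : Label → Fin m → Bool}

omit [Fintype V] [DecidableEq V] in
theorem encodeConf_startConf (hA₀ : eA ⟨.start, .advance, true⟩ = fun _ => false)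
    (hB₀ : eB .white = fun _ => false) :
    encodeConf eA eB (startConf r) = AgentConf.initial m m r := by
  simp [encodeConf, startConf, AgentConf.initial, hA₀, hB₀]

instance : Nonempty Mode := ⟨⟨.start, .advance, true⟩⟩

instance : Nonempty Label := ⟨.white⟩

/-- The agent on several nodes. -/
theorem exists_execution_of_deg_pos (hA : Function.Injective eA) (hB : Function.Injective eB)
    (hA₀ : eA ⟨.start, .advance, true⟩ = fun _ => false) (hB₀ : eB .white = fun _ => false)
    (hdeg : ∀ v, 0 < G.deg v) :
    ∃ (T : ℕ) (conf : ℕ → AgentConf V m m) (time : ℕ → ℕ),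
      G.Execution (RuleMachine.machine (bitRule rule eA eB) hm) r T conf time ∧
      T + 1 ≤
        (11 * Fintype.card V ^ 2 + 15 * Fintype.card V + 3) * (2 * Fintype.card V + 2) + 1 ∧
      (∀ t ≤ T, time t ≤ 3 * m + Fintype.card V + 1) ∧
      G.PerformsLexDFS r (fun x => (Function.invFun eB x).colour) T conf := by
  obtain ⟨T, conf, time, L, D, κ, h0, hT, htime, hmove, hhalt, hD0, hD, hend, hmono, hκ0, hκT,
    hcols, hatt⟩ := (completes_startConf (r := r) hdeg).exists_execution hm hA hB
  refine ⟨T, conf, time, ⟨h0.trans (encodeConf_startConf hA₀ hB₀), hmove, hhalt⟩, hT, htime,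
    L, D, κ, ⟨hD0, hD, hend⟩, hmono, hκ0, hκT, hcols, fun k hk u hu => ?_⟩
  exact (hatt k hk u hu).resolve_left fun h => h.2

/-- The agent on a single node. -/
theorem exists_execution_of_deg_eq_zero (hA : Function.Injective eA) (hB : Function.Injective eB)
    (hA₀ : eA ⟨.start, .advance, true⟩ = fun _ => false) (hB₀ : eB .white = fun _ => false)
    (hdeg : G.deg r = 0) :
    ∃ (conf : ℕ → AgentConf V m m) (time : ℕ → ℕ),
      G.Execution (RuleMachine.machine (bitRule rule eA eB) hm) r 0 conf time ∧
      (∀ t ≤ 0, time t ≤ 3 * m + Fintype.card V + 1) ∧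
      G.PerformsLexDFS r (fun x => (Function.invFun eB x).colour) 0 conf := by
  have hdec : ∀ l, Function.invFun eB (eB l) = l := Function.leftInverse_invFun hB
  obtain ⟨τ, hτ, hc⟩ := computes_bitRule (rule := rule) hm hA hB (a := ⟨.start, .advance, true⟩)
    (b := .white) (deg := G.deg r) (pin := none) (y := (⟨.start, .advance, true⟩, .black))
    (out := none) (by simp only [rule, hdeg]; exact .halt _ _) (by simp)
  have hle := G.deg_le_card r
  set a : LabelConf V Mode Label := startConf r with ha
  set col := Function.update (DFSState.initial V).colour r Colour.grey with hcol
  -- The only agent step both discovers and finishes the root, so `κ` jumps from `0` to `2`.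
  -- `GhostStep` allows one move per step, hence this run is given directly.
  refine ⟨prependSeq (encodeConf eA eB a) fun _ => encodeConf eA eB
      ⟨r, none, ⟨.start, .advance, true⟩, Function.update a.lab r .black⟩, fun _ => τ,
    ⟨encodeConf_startConf hA₀ hB₀, fun t ht => absurd ht (by omega), _, _, hc, ?_⟩,
    fun _ _ => hτ.trans (by omega), 2, prependSeq (DFSState.initial V) (prependSeq ⟨[r], col⟩
      fun _ => ⟨[], Function.update col r .black⟩), prependSeq 0 fun _ => 2,
    ⟨rfl, fun k hk => ?_, fun S' h => ?_⟩, ?_, rfl, rfl, fun t ht v => ?_, fun k hk u hu => ?_⟩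
  · simp only [prependSeq, encodeConf, encodeConf_update]
    rfl
  · interval_cases k
    · exact .start
    · refine .back r [] col fun x hx => ?_
      have := G.portNum_lt hx
      omega
  · simp only [prependSeq] at h
    generalize hS : (⟨[], Function.update col r .black⟩ : DFSState V) = S at h
    cases h with
    | start =>
      have := congrFun (congrArg DFSState.colour hS) r
      simp [DFSState.initial] at this
    | forward => simp at hS
    | back => simp at hS
  · refine monotone_nat_of_le_succ fun t => ?_
    rcases t with - | t
    · exact Nat.zero_le _
    · exact le_rfl
  · obtain rfl := eq_of_deg_eq_zero hdeg v
    rcases t with - | t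
    · simp only [prependSeq, encodeConf, hdec]
      rfl
    · simp only [prependSeq, encodeConf, hdec, Function.update_self]
      rfl
  · exact ⟨0, le_rfl, Nat.zero_le _, hk, (eq_of_deg_eq_zero hdeg u).symm⟩

end Encoding

end PortGraph

theorem theorem3 :
    (∃ (M : AgentMachine) (c s : ℕ) (colour : (Fin s → Bool) → Colour) (P : Polynomial ℕ),
      ∀ (V : Type u) [Fintype V] [DecidableEq V] (G : PortGraph V) (r : V),
        ∃ (T : ℕ) (conf : ℕ → AgentConf V c s) (time : ℕ → ℕ),
          G.Execution M r T conf time ∧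
          T + 1 ≤ P.eval (Fintype.card V) ∧
          (∀ t ≤ T, time t ≤ P.eval (Fintype.card V)) ∧
          G.PerformsLexDFS r colour T conf) ∧
    (∀ (V : Type u) [Fintype V] [DecidableEq V] (G : PortGraph V) (r : V) (S : DFSState V),
      Relation.ReflTransGen (G.LexMove r) (DFSState.initial V) S →
        G.GreyPathProperty r S) := by
  refine ⟨?_, fun V _ _ G r S h => (PortGraph.isRegular_of_reflTransGen h).greyPathProperty⟩
  obtain ⟨NA, hNA⟩ := exists_bitEncoding Mode ⟨.start, .advance, true⟩
  obtain ⟨NB, hNB⟩ := exists_bitEncoding Label .white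
  obtain ⟨m, hm, hmA, hmB⟩ : ∃ m, 0 < m ∧ NA ≤ m ∧ NB ≤ m :=
    ⟨NA + NB + 1, by omega, by omega, by omega⟩
  obtain ⟨eA, hA, hA₀⟩ := hNA m hmA
  obtain ⟨eB, hB, hB₀⟩ := hNB m hmB
  -- The polynomial is the sum of the bound on the agent steps and the bound on the machine steps
  -- within one of them, so it dominates both.
  refine ⟨RuleMachine.machine (PortGraph.bitRule rule eA eB) hm, m, m,
    fun x => (Function.invFun eB x).colour,
    (11 * Polynomial.X ^ 2 + 15 * Polynomial.X + 3) * (2 * Polynomial.X + 2) + 1 +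
      (3 * Polynomial.C m + Polynomial.X + 1), fun V _ _ G r => ?_⟩
  have heval : ((11 * Polynomial.X ^ 2 + 15 * Polynomial.X + 3) * (2 * Polynomial.X + 2) + 1 +
      (3 * Polynomial.C m + Polynomial.X + 1) : Polynomial ℕ).eval (Fintype.card V) =
      (11 * Fintype.card V ^ 2 + 15 * Fintype.card V + 3) * (2 * Fintype.card V + 2) + 1 +
        (3 * m + Fintype.card V + 1) := by
    simp
  rw [heval]
  by_cases hdeg : ∀ v, 0 < G.deg v
  · obtain ⟨T, conf, time, hex, hT, htime, hperf⟩ :=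
      PortGraph.exists_execution_of_deg_pos (r := r) hm hA hB hA₀ hB₀ hdeg
    exact ⟨T, conf, time, hex, hT.trans (Nat.le_add_right _ _),
      fun t ht => (htime t ht).trans (Nat.le_add_left _ _), hperf⟩
  · push Not at hdeg
    obtain ⟨v, hv⟩ := hdeg
    have hv0 : G.deg v = 0 := by omega
    -- By connectedness, a node of degree `0` is the only node, hence the root.
    obtain rfl := PortGraph.eq_of_deg_eq_zero hv0 r
    obtain ⟨conf, time, hex, htime, hperf⟩ :=
      PortGraph.exists_execution_of_deg_eq_zero hm hA hB hA₀ hB₀ hv0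
    exact ⟨0, conf, time, hex, by omega,
      fun t ht => (htime t ht).trans (Nat.le_add_left _ _), hperf⟩
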